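/- Let $\mathsf C,\mathsf E$ be arbitrary (possibly infinite-dimensional) complex Hilbert spaces, let $\mathsf A=\mathsf A'=\mathbb C^d$, and let $|\Phi\rangle=d^{-1/2}\sum_{i=1}^d|i\rangle_{\mathsf A'}|i\rangle_{\mathsf A}$. For a bounded operator $Y$ on $\mathsf A'\otimes\mathsf A\otimes\mathsf C\otimes\mathsf E$ and a unitary $U\in\mathbb U(d)$ acting on $\mathsf A$, let $\Theta(Y)(U)=d^2\langle\Phi|\,U_AYU_A^\dagger\,|\Phi\rangle$, an operator on $\mathsf C\otimes\mathsf E$, and let $\mathbf E_U$ be the integral with respect to the Haar probability measure on $\mathbb U(d)$. Let $\|T\|_p=(\operatorname{Tr}|T|^p)^{1/p}$ be the Schatten norms ($\|T\|_\infty$ is the operator norm), let $S_1$ be the class of operators with $\|T\|_1<\infty$, and, for $\alpha\ge1$ and $\frac1\alpha+\frac1{\alpha'}=1$, let $$\|Y\|_{S_1(\mathsf C\otimes\mathsf E,\,S_\alpha(\mathsf A\otimes\mathsf A'))}=\inf\big\{\|a\|_{2\alpha'}\|Z\|_\alpha\|b\|_{2\alpha'}\ :\ Y=(\mathbb 1_{AA'}\otimes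 a)\,Z\,(\mathbb 1_{AA'}\otimes b)\big\},$$ the infimum being over bounded operators $a,b$ on $\mathsf C\otimes\mathsf E$ and $Z$ on $\mathsf A'\otimes\mathsf A\otimes\mathsf C\otimes\mathsf E$. (i) For every $Y\in S_1(\mathsf A'\otimes\mathsf A\otimes\mathsf C\otimes\mathsf E)$ the function $U\mapsto\|\Theta(Y)(U)-\mathbf E_V\Theta(Y)(V)\|_1$ is measurable, and for every $\alpha\in[1,2]$ $$\mathbf E_U\big\|\Theta(Y)(U)-\mathbf E_V\Theta(Y)(V)\big\|_1\le 2\cdot3^{\frac{1-\alpha}{\alpha}}\,\|Y\|_{S_1(\mathsf C\otimes\mathsf E,\,S_\alpha(\mathsf A\otimes\mathsf A'))}.$$ (ii) For every positive bounded operator $\tau$ on $\mathsf A'\otimes\mathsf A\otimes\mathsf C\otimes\mathsf E$ and every $\alpha\in(1,2]$ $$\mathbf E_U\big\|\Theta(\tau)(U)-\mathbf E_V\Theta(\tau)(V)\big\|_1\le 2\exp\Big[\tfrac{1-\alpha}{\alpha}\big(H^*_\alpha(AA'|CE)_\tau+\log3\big)\Big],$$ where $$H^*_\alpha(AA'|CE)_\tau=-\alpha'\log\inf_\sigma\big\|(\mathbb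 1\otimes\sigma)^{-\frac1{2\alpha'}}\,\tau\,(\mathbb 1\otimes\sigma)^{-\frac1{2\alpha'}}\big\|_\alpha\in[-\infty,\infty],$$ with $\sigma$ ranging over the density operators on $\mathsf C\otimes\mathsf E$. Here the norm on the right is the infimum of $\|Z\|_\alpha$ over the bounded operators $Z$ with $\tau=(\mathbb 1\otimes\sigma^{\frac1{2\alpha'}})Z(\mathbb 1\otimes\sigma^{\frac1{2\alpha'}})$, and $\infty$ if there is none. For $\alpha=1$ the bound reads $\mathbf E_U\|\Theta(\tau)(U)-\mathbf E_V\Theta(\tau)(V)\|_1\le 2\operatorname{Tr}\tau$, which is $2$ if $\tau$ is a density operator. -/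

import Mathlib

open MeasureTheory
open scoped ENNReal TensorProduct InnerProductSpace

/-! ### Trace and Schatten norms on a Hilbert space of arbitrary dimension -/

section Schatten

variable {H : Type*} [NormedAddCommGroup H] [InnerProductSpace ℂ H] [CompleteSpace H]

/-- The trace `Tr T = ∑ᵢ ⟨bᵢ, T bᵢ⟩ ∈ [0, ∞]` of a positive operator `T`, computed in a Hilbert
basis of `H`; by `posTrace_eq_tsum` every Hilbert basis gives the same value. -/
noncomputable def posTrace (T : H →L[ℂ] H) : ℝ≥0∞ :=
  ∑' i, ENNReal.ofReal (RCLike.re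
    ⟪(exists_hilbertBasis ℂ H).choose_spec.choose i,
      T ((exists_hilbertBasis ℂ H).choose_spec.choose i)⟫_ℂ)

theorem HilbertBasis.tsum_enorm_inner_sq {ι : Type*} (b : HilbertBasis ι ℂ H) (x : H) :
    ∑' i, ENNReal.ofReal (‖⟪b i, x⟫_ℂ‖ ^ 2) = ENNReal.ofReal (‖x‖ ^ 2) := by
  have h := b.hasSum_inner_mul_inner x x
  have h2 : HasSum (fun i => ‖⟪b i, x⟫_ℂ‖ ^ 2) (‖x‖ ^ 2) := by
    have h3 := Complex.hasSum_re h
    rw [inner_self_eq_norm_sq_to_K] at h3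
    convert h3 using 1
    · funext i
      rw [← inner_conj_symm x (b i), RCLike.conj_mul]
      norm_cast
    · norm_cast
  rw [← ENNReal.ofReal_tsum_of_nonneg (fun i => by positivity) h2.summable, h2.tsum_eq]

theorem tsum_inner_eq_of_isPositive {ι κ : Type*} (b : HilbertBasis ι ℂ H)
    (c : HilbertBasis κ ℂ H) {T : H →L[ℂ] H} (hT : T.IsPositive) :
    ∑' i, ENNReal.ofReal (RCLike.re ⟪b i, T (b i)⟫_ℂ)
      = ∑' j, ENNReal.ofReal (RCLike.re ⟪c j, T (c j)⟫_ℂ) := by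
  have hT0 : 0 ≤ T := (ContinuousLinearMap.nonneg_iff_isPositive T).2 hT
  set S := CFC.sqrt T with hS
  have hSS : S * S = T := CFC.sqrt_mul_sqrt_self T hT0
  have hS0 : S.IsPositive :=
    (ContinuousLinearMap.nonneg_iff_isPositive S).1 (CFC.sqrt_nonneg T)
  have hsymm : ∀ x y, ⟪S x, y⟫_ℂ = ⟪x, S y⟫_ℂ := hS0.isSymmetric
  have key : ∀ x, RCLike.re ⟪x, T x⟫_ℂ = ‖S x‖ ^ 2 := by
    intro x
    rw [← hSS, mul_apply_eq_comp, ← hsymm, inner_self_eq_norm_sq]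
  simp only [key]
  calc ∑' i, ENNReal.ofReal (‖S (b i)‖ ^ 2)
      = ∑' i, ∑' j, ENNReal.ofReal (‖⟪c j, S (b i)⟫_ℂ‖ ^ 2) := by
        simp only [c.tsum_enorm_inner_sq]
    _ = ∑' j, ∑' i, ENNReal.ofReal (‖⟪c j, S (b i)⟫_ℂ‖ ^ 2) := ENNReal.tsum_comm
    _ = ∑' j, ∑' i, ENNReal.ofReal (‖⟪b i, S (c j)⟫_ℂ‖ ^ 2) := by
        refine tsum_congr fun j => tsum_congr fun i => ?_
        rw [← hsymm, norm_inner_symm]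
    _ = ∑' j, ENNReal.ofReal (‖S (c j)‖ ^ 2) := by
        simp only [b.tsum_enorm_inner_sq]

/-- The trace of a positive operator may be computed in any Hilbert basis. -/
theorem posTrace_eq_tsum {ι : Type*} (b : HilbertBasis ι ℂ H) {T : H →L[ℂ] H}
    (hT : T.IsPositive) :
    posTrace T = ∑' i, ENNReal.ofReal (RCLike.re ⟪b i, T (b i)⟫_ℂ) :=
  tsum_inner_eq_of_isPositive _ b hT

/-- The Schatten norm `‖T‖_p = (Tr |T|^p)^{1/p} ∈ [0, ∞]` for `0 < p < ∞`, and the operator norm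
for `p = ∞`. The class `S_p(H)` consists of the bounded operators with `‖T‖_p < ∞`. -/
noncomputable def schattenNorm (p : ℝ≥0∞) (T : H →L[ℂ] H) : ℝ≥0∞ :=
  if p = ∞ then ‖T‖ₑ else posTrace (CFC.abs T ^ p.toReal) ^ (1 / p.toReal)

/-- Density operators: positive operators of trace one. -/
def IsDensityOperator (σ : H →L[ℂ] H) : Prop :=
  σ.IsPositive ∧ posTrace σ = 1

end Schatten

/-! ### The Hilbert spaces -/

/-- The Hilbert space tensor product: the completion of the algebraic tensor product for the
inner product `⟨x ⊗ y, x' ⊗ y'⟩ = ⟨x, x'⟩ ⟨y, y'⟩`. -/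
abbrev HilbertTensor (C E : Type*) [NormedAddCommGroup C] [InnerProductSpace ℂ C]
    [NormedAddCommGroup E] [InnerProductSpace ℂ E] : Type _ :=
  UniformSpace.Completion (C ⊗[ℂ] E)

/-- The Hilbert space `A' ⊗ A ⊗ R` with `A' = A = ℂ^d`, as the `ℓ²`-sum of copies of `R` indexed by
the pairs `(i, j)`: the family `ξ` stands for `∑ i j, |i⟩_{A'} ⊗ |j⟩_A ⊗ ξ (i, j)`. -/
abbrev AATensor (d : ℕ) (R : Type*) : Type _ :=
  PiLp 2 (fun _ : Fin d × Fin d => R)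

section Operators

variable {d : ℕ} {R : Type*} [NormedAddCommGroup R] [InnerProductSpace ℂ R]

/-- The bounded operator into `A' ⊗ A ⊗ R` with the given components. -/
noncomputable def AATensor.mk {V : Type*} [NormedAddCommGroup V] [InnerProductSpace ℂ V]
    (f : Fin d × Fin d → V →L[ℂ] R) : V →L[ℂ] AATensor d R :=
  ((PiLp.continuousLinearEquiv 2 ℂ (fun _ : Fin d × Fin d => R)).symm :
    (Fin d × Fin d → R) →L[ℂ] AATensor d R) ∘L ContinuousLinearMap.pi f

@[simp] theorem AATensor.mk_apply {V : Type*} [NormedAddCommGroup V] [InnerProductSpace ℂ V]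
    (f : Fin d × Fin d → V →L[ℂ] R) (v : V) (q : Fin d × Fin d) :
    AATensor.mk f v q = f q v := rfl

/-- The operator `1_{A'A} ⊗ a` on `A' ⊗ A ⊗ R`. -/
noncomputable def onR (d : ℕ) (a : R →L[ℂ] R) : AATensor d R →L[ℂ] AATensor d R :=
  AATensor.mk fun q => a ∘L PiLp.proj 2 (fun _ : Fin d × Fin d => R) q

/-- The operator `1_{A'} ⊗ M ⊗ 1_R` on `A' ⊗ A ⊗ R`. -/
noncomputable def onA (R : Type*) [NormedAddCommGroup R] [InnerProductSpace ℂ R]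
    (M : Matrix (Fin d) (Fin d) ℂ) : AATensor d R →L[ℂ] AATensor d R :=
  AATensor.mk fun q => ∑ k, M q.2 k • PiLp.proj 2 (fun _ : Fin d × Fin d => R) (q.1, k)

/-- The operator `|Φ⟩ ⊗ 1_R : R → A' ⊗ A ⊗ R`, where
`|Φ⟩ = d^{-1/2} ∑ i, |i⟩_{A'} ⊗ |i⟩_A` is the maximally entangled vector. -/
noncomputable def ketPhi (d : ℕ) (R : Type*) [NormedAddCommGroup R] [InnerProductSpace ℂ R] :
    R →L[ℂ] AATensor d R :=
  ((1 / Real.sqrt d : ℝ) : ℂ) •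
    AATensor.mk fun q => if q.1 = q.2 then ContinuousLinearMap.id ℂ R else 0

end Operators

/-! ### Haar measure on the unitary group -/

noncomputable instance unitaryGroupMeasurableSpace (d : ℕ) :
    MeasurableSpace (Matrix.unitaryGroup (Fin d) ℂ) := borel _

instance unitaryGroupBorelSpace (d : ℕ) : BorelSpace (Matrix.unitaryGroup (Fin d) ℂ) := ⟨rfl⟩

instance unitaryGroupCompactSpace (d : ℕ) : CompactSpace (Matrix.unitaryGroup (Fin d) ℂ) := by
  refine isCompact_iff_compactSpace.mp ?_
  have hK : IsCompact (Set.pi Set.univ fun _ : Fin d =>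
      Set.pi Set.univ fun _ : Fin d => Metric.closedBall (0 : ℂ) 1) :=
    isCompact_univ_pi fun _ => isCompact_univ_pi fun _ => isCompact_closedBall _ _
  refine IsCompact.of_isClosed_subset (X := Matrix (Fin d) (Fin d) ℂ) hK
    (isClosed_unitary (R := Matrix (Fin d) (Fin d) ℂ)) ?_
  intro U hU i _ j _
  simpa using entry_norm_bound_of_unitary hU i j

/-- The Haar probability measure on the unitary group `U(A)`, `A = ℂ^d`. -/
noncomputable def haarUnitary (d : ℕ) : Measure (Matrix.unitaryGroup (Fin d) ℂ) :=
  Measure.haarMeasure ⊤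

instance haarUnitary_isProbabilityMeasure (d : ℕ) : IsProbabilityMeasure (haarUnitary d) :=
  ⟨Measure.haarMeasure_self⟩

/-! ### The decoupling map -/

section Decoupling

variable {d : ℕ} {R : Type*} [NormedAddCommGroup R] [InnerProductSpace ℂ R] [CompleteSpace R]

/-- The decoupling map `Θ(Y)(U) = d² ⟨Φ| U_A Y U_A† |Φ⟩`, an operator on `R`. -/
noncomputable def Theta (Y : AATensor d R →L[ℂ] AATensor d R)
    (U : Matrix.unitaryGroup (Fin d) ℂ) : R →L[ℂ] R :=
  ((d : ℂ) ^ 2) • ((ketPhi d R).adjoint ∘L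
    (onA R (U : Matrix (Fin d) (Fin d) ℂ) ∘L Y ∘L
      (onA R (U : Matrix (Fin d) (Fin d) ℂ)).adjoint) ∘L ketPhi d R)

/-- The trace norm `‖Θ(Y)(U) - E_V Θ(Y)(V)‖₁`. -/
noncomputable def decouplingDeviation (Y : AATensor d R →L[ℂ] AATensor d R)
    (U : Matrix.unitaryGroup (Fin d) ℂ) : ℝ≥0∞ :=
  schattenNorm 1 (Theta Y U - ∫ V, Theta Y V ∂haarUnitary d)

/-- The decoupling error `E_U ‖Θ(Y)(U) - E_V Θ(Y)(V)‖₁`. -/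
noncomputable def decouplingError (Y : AATensor d R →L[ℂ] AATensor d R) : ℝ≥0∞ :=
  ∫⁻ U, decouplingDeviation Y U ∂haarUnitary d

/-! ### The norm of `S_1(R, S_α(AA'))` and the conditional entropy -/

/-- The norm of `S_1(R, S_α(AA'))`, for `α ≥ 1`: the infimum of
`‖a‖_{2α'} ‖Z‖_α ‖b‖_{2α'}` over all factorizations `X = (1 ⊗ a) Z (1 ⊗ b)` with `a, b ∈ B(R)` and
`Z` bounded, where `1/α + 1/α' = 1` (`α' = ∞` for `α = 1`). -/
noncomputable def normS1 (α : ℝ) (X : AATensor d R →L[ℂ] AATensor d R) : ℝ≥0∞ :=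
  ⨅ (a : R →L[ℂ] R) (b : R →L[ℂ] R) (Z : AATensor d R →L[ℂ] AATensor d R)
    (_ : X = onR d a ∘L Z ∘L onR d b),
    schattenNorm (2 * ENNReal.conjExponent (ENNReal.ofReal α)) a * schattenNorm (ENNReal.ofReal α) Z
      * schattenNorm (2 * ENNReal.conjExponent (ENNReal.ofReal α)) b

/-- The quantity `‖(1 ⊗ σ)^{-s} τ (1 ⊗ σ)^{-s}‖_α` for a density operator `σ` on `R` and `s ≥ 0`.
As `σ` need not have a bounded inverse, it is the least value of `‖Z‖_α` over the bounded operators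
`Z` with `τ = (1 ⊗ σ^s) Z (1 ⊗ σ^s)`, and `∞` if there is no such `Z`. (Among these `Z`, the one
living on the support of `1 ⊗ σ` is a compression of all the others, hence has the least norm.) -/
noncomputable def sandwichedNorm (α s : ℝ) (σ : R →L[ℂ] R)
    (τ : AATensor d R →L[ℂ] AATensor d R) : ℝ≥0∞ :=
  ⨅ (Z : AATensor d R →L[ℂ] AATensor d R) (_ : τ = onR d (σ ^ s) ∘L Z ∘L onR d (σ ^ s)),
    schattenNorm (ENNReal.ofReal α) Z

/-- The sandwiched conditional Rényi entropy of order `α > 1`,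
`H*_α(AA'|R)_τ = -α' log inf_σ ‖(1 ⊗ σ)^{-1/(2α')} τ (1 ⊗ σ)^{-1/(2α')}‖_α`, the infimum being over
the density operators `σ` on `R`, with `α' = α/(α-1)`. It takes values in `[-∞, ∞]`
(with `log 0 = -∞` and `log ∞ = ∞`). -/
noncomputable def sandwichedEntropy (α : ℝ) (τ : AATensor d R →L[ℂ] AATensor d R) : EReal :=
  -((α / (α - 1) : ℝ) : EReal) *
    ENNReal.log (⨅ (σ : R →L[ℂ] R) (_ : IsDensityOperator σ),
      sandwichedNorm α (1 / (2 * (α / (α - 1)))) σ τ)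

end Decoupling

/-!
The centred decoupling map has finitely many coefficients: in terms of the blocks
`Y_{qq'} = ⟨q| Y |q'⟩`, with `q = (i, j)`,
`Θ(Y)(U) - E_V Θ(Y)(V) = ∑ q q', (d U_q conj U_{q'} - δ_{qq'}) Y_{qq'}` (`theta_sub_integral_eq`).
The bound is obtained by complex interpolation between `α = 1` and `α = 2`.

* `α = 1` (`integral_norm_deviationFunctional_le`). On an operator `|x⟩⟨y|` of rank one,
  `Θ(|x⟩⟨y|)(U) = |ξ(U)⟩⟨η(U)|` with `E ‖ξ(U)‖² = ‖x‖²` and `E ‖η(U)‖² = ‖y‖²`, so that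
  `E ‖Θ(|x⟩⟨y|)‖₁ ≤ ‖x‖ ‖y‖`; subtracting the mean costs a factor `2`.
* `α = 2` (`integral_norm_deviationFunctional_le_schatten_two`). The fourth moments of a Haar
  unitary are given by the Weingarten formula (`haarMoment₄_eq`), and bound the variance of a matrix
  element of `Θ(Z)` by `d² / (d² - 1) ≤ 4 / 3` times a squared Hilbert-Schmidt norm
  (`integral_norm_sq_thetaCoeff_le`; for `d = 1` the deviation vanishes). Hölder's inequality
  `‖a X b‖₁ ≤ ‖a‖₄ ‖X‖₂ ‖b‖₄` (`norm_deviationFunctional_le`) brings in the factors `a` and `b`.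
* In between (`decouplingError_finiteRank_le`). If `a`, `Z`, `b` have finite rank, their singular
  values are raised to complex powers. To avoid interpolation of Schatten classes, the deviation is
  represented by the functional `G ↦ Tr (G X)` on `B(R)`, whose norm bounds `‖X‖₁`
  (`schattenNorm_one_le_of_functional`); the Hadamard three lines theorem then applies to a finite
  exponential sum with values in `L¹(U(d), B(R)*)`. At `θ = 2 (α - 1) / α` the constants combine to
  `2 ^ (1 - θ) (2 / √3) ^ θ = 2 · 3 ^ ((1 - α) / α)`.

General `a`, `Z`, `b` are limits in operator norm of finite-rank operators with no larger Schatten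
norms (`exists_finiteRank_approx`, by soft thresholding of the singular values), and the decoupling
error is lower semicontinuous by Fatou's lemma (`decouplingError_le_of_tendsto`). In the second
part, `a = b = σ ^ (1 / (2α'))` has `‖a‖_{2α'} = 1`, so the infimum that defines the entropy is at
least the norm of `S_1(R, S_α(AA'))`. Nothing depends on the tensor structure of `R = C ⊗ E`.
-/

/-! ### Schatten norms: semicontinuity, trace duality, finite-rank approximation -/

section SchattenTools

variable {H : Type*} [NormedAddCommGroup H] [InnerProductSpace ℂ H] [CompleteSpace H]

theorem schattenNorm_ofReal {p : ℝ} (hp : 0 ≤ p) (T : H →L[ℂ] H) :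
    schattenNorm (ENNReal.ofReal p) T = posTrace (CFC.abs T ^ p) ^ (1 / p) := by
  rw [schattenNorm, if_neg ENNReal.ofReal_ne_top, ENNReal.toReal_ofReal hp]

theorem schattenNorm_one_eq (T : H →L[ℂ] H) : schattenNorm 1 T = posTrace (CFC.abs T) := by
  rw [schattenNorm, if_neg ENNReal.one_ne_top, ENNReal.toReal_one,
    CFC.rpow_one _ (CFC.abs_nonneg T)]
  simp

theorem lowerSemicontinuous_schattenNorm_one :
    LowerSemicontinuous (schattenNorm 1 : (H →L[ℂ] H) → ℝ≥0∞) := by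
  have h : (schattenNorm 1 : (H →L[ℂ] H) → ℝ≥0∞) = fun T => posTrace (CFC.abs T) :=
    funext schattenNorm_one_eq
  rw [h]
  refine lowerSemicontinuous_tsum fun i => Continuous.lowerSemicontinuous ?_
  have h1 : Continuous (CFC.abs : (H →L[ℂ] H) → (H →L[ℂ] H)) := CFC.continuous_abs
  refine ENNReal.continuous_ofReal.comp (RCLike.continuous_re.comp ?_)
  exact continuous_const.inner (h1.clm_apply continuous_const)

/-- The compression of a positive operator to the span of an orthonormal family has smaller
trace. -/
theorem sum_inner_le_posTrace {n : ℕ} {v : Fin n → H} (hv : Orthonormal ℂ v) {P : H →L[ℂ] H}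
    (hP : P.IsPositive) :
    ∑ i, ENNReal.ofReal (RCLike.re ⟪v i, P (v i)⟫_ℂ) ≤ posTrace P := by
  obtain ⟨w, b, hw, hb⟩ := hv.toSubtypeRange.exists_hilbertBasis_extension
  rw [posTrace_eq_tsum b hP]
  have hinj : Function.Injective fun i => (⟨v i, hw (Set.mem_range_self i)⟩ : w) := fun i j h =>
    hv.linearIndependent.injective (congrArg Subtype.val h)
  calc ∑ i, ENNReal.ofReal (RCLike.re ⟪v i, P (v i)⟫_ℂ)
      = ∑' i, (fun x : w => ENNReal.ofReal (RCLike.re ⟪b x, P (b x)⟫_ℂ))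
          ⟨v i, hw (Set.mem_range_self i)⟩ := by
        rw [tsum_fintype]; simp [hb]
    _ ≤ _ := ENNReal.tsum_comp_le_tsum_of_injective hinj _

/-- The functional `G ↦ Tr (G |x⟩⟨y|) = ⟨y, G x⟩` on `B(H)`. -/
noncomputable def rankOneFunctional (x y : H) : StrongDual ℂ (H →L[ℂ] H) :=
  (innerSL ℂ y) ∘L (ContinuousLinearMap.apply ℂ H x)

omit [CompleteSpace H] in
@[simp] theorem rankOneFunctional_apply (x y : H) (G : H →L[ℂ] H) :
    rankOneFunctional x y G = ⟪y, G x⟫_ℂ := rfl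

theorem norm_rankOneFunctional_le (x y : H) : ‖rankOneFunctional x y‖ ≤ ‖x‖ * ‖y‖ := by
  refine ContinuousLinearMap.opNorm_le_bound _ (by positivity) fun G => ?_
  rw [rankOneFunctional_apply]
  calc ‖⟪y, G x⟫_ℂ‖ ≤ ‖y‖ * ‖G x‖ := norm_inner_le_norm _ _
    _ ≤ ‖y‖ * (‖G‖ * ‖x‖) := by gcongr; exact G.le_opNorm x
    _ = ‖x‖ * ‖y‖ * ‖G‖ := by ring

omit [CompleteSpace H] in
theorem norm_sq_sum_smul_of_orthonormal {ι : Type*} {e : ι → H} (he : Orthonormal ℂ e)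
    (F : Finset ι) (c : ι → ℂ) : ‖∑ i ∈ F, c i • e i‖ ^ 2 = ∑ i ∈ F, ‖c i‖ ^ 2 := by
  have h := he.inner_sum c c F
  rw [inner_self_eq_norm_sq_to_K] at h
  simp only [RCLike.conj_mul] at h
  exact_mod_cast h

omit [CompleteSpace H] in
theorem norm_sum_rankOne_le_one {ι : Type*} {e f : ι → H} (he : Orthonormal ℂ e)
    (hf : Orthonormal ℂ f) (F : Finset ι) {c : ι → ℂ} (hc : ∀ i, ‖c i‖ ≤ 1) :
    ‖∑ i ∈ F, c i • InnerProductSpace.rankOne ℂ (e i) (f i)‖ ≤ 1 := by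
  refine ContinuousLinearMap.opNorm_le_bound _ zero_le_one fun x => ?_
  rw [one_mul]
  refine le_of_sq_le_sq ?_ (norm_nonneg _)
  have h1 : (∑ i ∈ F, c i • InnerProductSpace.rankOne ℂ (e i) (f i)) x
      = ∑ i ∈ F, (c i * ⟪f i, x⟫_ℂ) • e i := by
    simp [mul_smul]
  rw [h1, norm_sq_sum_smul_of_orthonormal he]
  refine le_trans (Finset.sum_le_sum fun i _ => ?_) (hf.sum_inner_products_le x (s := F))
  rw [norm_mul]
  have := hc i
  gcongr
  exact mul_le_of_le_one_left (norm_nonneg _) this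

/-- Trace duality: if the functional `φ` on `B(H)` is `G ↦ Tr (G X)` on operators of rank one, then
`‖X‖₁ ≤ ‖φ‖`. -/
theorem schattenNorm_one_le_of_functional {X : H →L[ℂ] H} {φ : StrongDual ℂ (H →L[ℂ] H)}
    (h : ∀ u v, φ (InnerProductSpace.rankOne ℂ u v) = ⟪v, X u⟫_ℂ) :
    schattenNorm 1 X ≤ ‖φ‖ₑ := by
  set A := CFC.abs X with hA
  have hA0 : 0 ≤ A := CFC.abs_nonneg X
  have hAs : IsSelfAdjoint A := hA0.isSelfAdjoint
  have hspec : ∀ t ∈ spectrum ℝ A, 0 ≤ t := fun t ht => spectrum_nonneg_of_nonneg hA0 ht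
  have hApos : A.IsPositive := (ContinuousLinearMap.nonneg_iff_isPositive A).1 hA0
  obtain ⟨w, b, hb⟩ := exists_hilbertBasis ℂ H
  rw [schattenNorm_one_eq, posTrace_eq_tsum b hApos, ENNReal.tsum_eq_iSup_sum]
  refine iSup_le fun F => ?_
  rw [← ENNReal.ofReal_sum_of_nonneg (fun i _ => hApos.re_inner_nonneg_right _),
    ← ofReal_norm]
  refine ENNReal.ofReal_le_ofReal (le_of_forall_pos_le_add fun η hη => ?_)
  obtain ⟨δ, hδ, hδη⟩ : ∃ δ > 0, F.card * δ ≤ η := by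
    refine ⟨η / (F.card + 1), by positivity, ?_⟩
    rw [mul_div_assoc', div_le_iff₀ (by positivity)]
    nlinarith
  -- a regularized polar decomposition: `G X = |X|² (|X| + δ)⁻¹` is close to `|X|`
  set k : ℝ → ℝ := fun t => (|t| + δ)⁻¹ with hk
  have hkc : Continuous k := by
    refine Continuous.inv₀ (by fun_prop) fun t => ?_
    positivity
  have hAA : star X * X = cfc (fun t : ℝ => t * t) A := by
    rw [cfc_mul (fun t : ℝ => t) (fun t => t) A, cfc_id' ℝ A, hA, CFC.abs_mul_abs]
  set G := cfc k A * star X with hG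
  have hGX : G * X = cfc (fun t : ℝ => k t * (t * t)) A := by
    rw [hG, mul_assoc, hAA, ← cfc_mul k (fun t : ℝ => t * t) A hkc.continuousOn]
  have hG1 : ‖G‖ ≤ 1 := by
    have h1 : G * star G = cfc (fun t : ℝ => k t * (t * t) * k t) A := by
      have h2 : star G = X * cfc k A := by
        rw [hG, star_mul, star_star, (cfc_predicate k A : IsSelfAdjoint _).star_eq]
      rw [h2, ← mul_assoc, hGX, ← cfc_mul _ k A (by fun_prop) hkc.continuousOn]
    have h3 : ‖G‖ * ‖G‖ ≤ 1 := by
      rw [← CStarRing.norm_self_mul_star, h1]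
      refine norm_cfc_le zero_le_one fun t ht => ?_
      have ht0 := hspec t ht
      rw [hk, Real.norm_eq_abs, abs_of_nonneg (by positivity)]
      simp only [abs_of_nonneg ht0]
      have : (t + δ)⁻¹ * (t * t) * (t + δ)⁻¹ = (t / (t + δ)) ^ 2 := by
        field_simp
      rw [this]
      refine pow_le_one₀ (by positivity) ?_
      rw [div_le_one (by positivity)]
      linarith
    nlinarith [norm_nonneg G]
  have hclose : ‖A - G * X‖ ≤ δ := by
    rw [hGX, ← cfc_id' ℝ A, cfc_id' ℝ A]
    nth_rewrite 1 [← cfc_id' ℝ A]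
    rw [← cfc_sub (fun t : ℝ => t) _ A (by fun_prop) (by fun_prop)]
    refine norm_cfc_le hδ.le fun t ht => ?_
    have ht0 := hspec t ht
    rw [hk]
    simp only [abs_of_nonneg ht0]
    have : t - (t + δ)⁻¹ * (t * t) = δ * (t / (t + δ)) := by
      field_simp; ring
    rw [this, Real.norm_eq_abs, abs_of_nonneg (by positivity)]
    refine mul_le_of_le_one_right hδ.le ?_
    rw [div_le_one (by positivity)]
    linarith
  -- `Tr (K X)` is the partial trace of `G X` over the basis vectors in `F`
  set K : H →L[ℂ] H := ∑ i ∈ F, InnerProductSpace.rankOne ℂ (b i) (star G (b i)) with hK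
  have hK1 : ‖K‖ ≤ 1 := by
    have h1 : K = (∑ i ∈ F, (1 : ℂ) • InnerProductSpace.rankOne ℂ (b i) (b i)) * G := by
      ext x
      simp only [hK, one_smul, _root_.sum_apply, InnerProductSpace.rankOne_apply,
        mul_apply_eq_comp]
      refine Finset.sum_congr rfl fun i _ => ?_
      rw [ContinuousLinearMap.star_eq_adjoint, ContinuousLinearMap.adjoint_inner_left]
    rw [h1]
    refine (norm_mul_le _ _).trans (mul_le_one₀ ?_ (norm_nonneg _) hG1)
    exact norm_sum_rankOne_le_one b.orthonormal b.orthonormal F (fun _ => by simp)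
  have hφ : φ K = ∑ i ∈ F, ⟪b i, (G * X) (b i)⟫_ℂ := by
    rw [hK, map_sum]
    refine Finset.sum_congr rfl fun i _ => ?_
    rw [h, ContinuousLinearMap.star_eq_adjoint, ContinuousLinearMap.adjoint_inner_left]
    rfl
  have h5 : ∑ i ∈ F, RCLike.re ⟪b i, A (b i)⟫_ℂ
      ≤ RCLike.re (φ K) + ∑ i ∈ F, δ := by
    rw [hφ, map_sum, ← Finset.sum_add_distrib]
    refine Finset.sum_le_sum fun i _ => ?_
    have h6 : ⟪b i, A (b i)⟫_ℂ = ⟪b i, (G * X) (b i)⟫_ℂ + ⟪b i, (A - G * X) (b i)⟫_ℂ := by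
      rw [← inner_add_right, ← _root_.add_apply, add_sub_cancel]
    rw [h6, map_add]
    gcongr
    refine (RCLike.re_le_norm _).trans ((norm_inner_le_norm _ _).trans ?_)
    rw [b.orthonormal.1 i, one_mul]
    refine (ContinuousLinearMap.le_opNorm _ _).trans ?_
    rwa [b.orthonormal.1 i, mul_one]
  rw [Finset.sum_const, nsmul_eq_mul] at h5
  have h7 : RCLike.re (φ K) ≤ ‖φ‖ := (RCLike.re_le_norm _).trans
    ((φ.le_opNorm K).trans (mul_le_of_le_one_right (norm_nonneg _) hK1))
  linarith

theorem tangent_le_rpow {p t r : ℝ} (hp : 1 ≤ p) (ht : 0 ≤ t) (hr : 0 < r) :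
    r ^ p + p * r ^ (p - 1) * (t - r) ≤ t ^ p := by
  have h := one_add_mul_self_le_rpow_one_add (s := t / r - 1) (p := p)
    (by have : 0 ≤ t / r := by positivity
        linarith) hp
  have h1 : (1 + (t / r - 1)) ^ p = t ^ p / r ^ p := by
    rw [add_sub_cancel, Real.div_rpow ht hr.le]
  rw [h1, le_div_iff₀ (by positivity)] at h
  have h2 : r ^ (p - 1) * r = r ^ p := by
    rw [← Real.rpow_add_one hr.ne', sub_add_cancel]
  calc r ^ p + p * r ^ (p - 1) * (t - r)
      = (1 + p * (t / r - 1)) * r ^ p := by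
        rw [← h2]; field_simp
    _ ≤ t ^ p := h

/-- Jensen's inequality for the power `A ^ p`, linearized at `r`. -/
theorem tangent_le_inner_rpow {A : H →L[ℂ] H} (hA : 0 ≤ A) {p r : ℝ} (hp : 1 ≤ p) (hr : 0 < r)
    (x : H) : r ^ p * ‖x‖ ^ 2 + p * r ^ (p - 1) * (RCLike.re ⟪x, A x⟫_ℂ - r * ‖x‖ ^ 2)
      ≤ RCLike.re ⟪x, (A ^ p) x⟫_ℂ := by
  have hAs : IsSelfAdjoint A := hA.isSelfAdjoint
  set c := p * r ^ (p - 1) with hc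
  have h1 : cfc (fun t : ℝ => (r ^ p - c * r) + c * t) A ≤ cfc (fun t : ℝ => t ^ p) A := by
    refine cfc_mono (fun t ht => ?_) (by fun_prop)
      (Real.continuous_rpow_const (by linarith)).continuousOn
    have := tangent_le_rpow hp (spectrum_nonneg_of_nonneg hA ht) hr
    simp only [← hc] at this
    linarith
  rw [← CFC.rpow_eq_cfc_real hA, cfc_const_add _ (fun t : ℝ => c * t) A,
    cfc_const_mul c (fun t : ℝ => t) A, cfc_id' ℝ A] at h1
  have h2 := ((ContinuousLinearMap.le_def _ _).1 h1).re_inner_nonneg_right x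
  simp only [_root_.sub_apply, _root_.add_apply, inner_sub_right, inner_add_right, map_sub,
    map_add, _root_.smul_apply, Algebra.algebraMap_eq_smul_one, one_apply_eq_self] at h2
  have h3 : ∀ (a : ℝ) (y : H), RCLike.re ⟪x, a • y⟫_ℂ = a * RCLike.re ⟪x, y⟫_ℂ := fun a y => by
    rw [inner_smul_right_eq_smul, RCLike.smul_re]
  simp only [h3, inner_self_eq_norm_sq] at h2
  linarith

/-- Soft thresholding at level `ε`: the operator `T' = T g(|T|)` with
`g(t) = (t - ε)₊ / max t ε` is `ε`-close to `T` and satisfies `|T'| = B := (|T| - ε)₊`. -/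
theorem exists_softThreshold (T : H →L[ℂ] H) {ε : ℝ} (hε : 0 < ε) :
    ∃ B T' : H →L[ℂ] H, B.IsPositive ∧ star T' * T' = B * B ∧ ‖T - T'‖ ≤ ε ∧
      CFC.abs T * B = ε • B + B * B := by
  set A := CFC.abs T with hA
  have hA0 : 0 ≤ A := CFC.abs_nonneg T
  have hAs : IsSelfAdjoint A := hA0.isSelfAdjoint
  have hspec : ∀ t ∈ spectrum ℝ A, 0 ≤ t := fun t ht => spectrum_nonneg_of_nonneg hA0 ht
  obtain ⟨f, hf⟩ : ∃ f : ℝ → ℝ, f = fun t => max (t - ε) 0 := ⟨_, rfl⟩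
  obtain ⟨g, hg⟩ : ∃ g : ℝ → ℝ, g = fun t => max (t - ε) 0 / max t ε := ⟨_, rfl⟩
  have hfc : Continuous f := by rw [hf]; fun_prop
  have hgc : Continuous g := by
    rw [hg]
    refine Continuous.div (by fun_prop) (by fun_prop) fun t => ?_
    exact (lt_of_lt_of_le hε (le_max_right _ _)).ne'
  have htg : ∀ t, 0 ≤ t → t * g t = f t := by
    intro t ht
    simp only [hg, hf]
    rcases le_total t ε with h | h
    · rw [max_eq_right (by linarith : t - ε ≤ 0)]; simp
    · rw [max_eq_left h]
      have : t ≠ 0 := by linarith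
      field_simp
  have hAA : star T * T = cfc (fun t : ℝ => t * t) A := by
    rw [cfc_mul (fun t : ℝ => t) (fun t => t) A, cfc_id' ℝ A, hA, CFC.abs_mul_abs]
  have hcomp : ∀ k : ℝ → ℝ, Continuous k →
      star (T * cfc k A) * (T * cfc k A) = cfc (fun t : ℝ => t * k t * (t * k t)) A := by
    intro k hk
    rw [star_mul, (cfc_predicate k A : IsSelfAdjoint _).star_eq, mul_assoc, ← mul_assoc (star T),
      hAA, ← cfc_mul _ k A (by fun_prop) hk.continuousOn,
      ← cfc_mul k _ A hk.continuousOn (by fun_prop)]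
    congr 1; ext t; ring
  have hT'B : star (T * cfc g A) * (T * cfc g A) = cfc f A * cfc f A := by
    rw [hcomp g hgc, ← cfc_mul f f A hfc.continuousOn hfc.continuousOn]
    exact cfc_congr fun t ht => by simp only [htg t (hspec t ht)]
  have hnorm : ‖T - T * cfc g A‖ ≤ ε := by
    have h1 : T - T * cfc g A = T * cfc (fun t => 1 - g t) A := by
      rw [cfc_sub (fun _ => (1 : ℝ)) g A continuousOn_const hgc.continuousOn, cfc_const_one ℝ A,
        mul_sub, mul_one]
    have h2 : ‖T - T * cfc g A‖ * ‖T - T * cfc g A‖ ≤ ε * ε := by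
      rw [← CStarRing.norm_star_mul_self, h1, hcomp _ (by fun_prop)]
      refine norm_cfc_le (by positivity) fun t ht => ?_
      have h3 : t * (1 - g t) = t - f t := by rw [mul_sub, mul_one, htg t (hspec t ht)]
      have h4 : |t - f t| ≤ ε := by
        have := hspec t ht
        simp only [hf]
        rcases le_total t ε with h | h
        · rw [max_eq_right (by linarith : t - ε ≤ 0), abs_le]; constructor <;> linarith
        · rw [max_eq_left (by linarith : 0 ≤ t - ε), abs_le]; constructor <;> linarith
      rw [h3, norm_mul, Real.norm_eq_abs]
      gcongr
    exact abs_le_of_sq_le_sq' (by nlinarith) hε.le |>.2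
  have hshift : A * cfc f A = ε • cfc f A + cfc f A * cfc f A := by
    rw [← cfc_mul f f A hfc.continuousOn hfc.continuousOn, ← cfc_const_mul ε f A hfc.continuousOn,
      ← cfc_add A (fun t => ε * f t) _ (by fun_prop)
      (by fun_prop)]
    nth_rewrite 1 [← cfc_id' ℝ A]
    rw [← cfc_mul (fun t : ℝ => t) f A (by fun_prop) hfc.continuousOn]
    refine cfc_congr fun t _ => ?_
    simp only [hf]
    rcases le_total t ε with h | h
    · rw [max_eq_right (by linarith : t - ε ≤ 0)]; ring
    · rw [max_eq_left (by linarith : 0 ≤ t - ε)]; ring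
  exact ⟨cfc f A, T * cfc g A, (ContinuousLinearMap.nonneg_iff_isPositive _).1
    (cfc_nonneg fun t _ => by rw [hf]; exact le_max_right _ _), hT'B, hnorm, hshift⟩

/-- **Finite-rank approximation.** An operator with `Tr |T|^p < ∞`, `p ≥ 1`, is approximated in
operator norm by operators of finite rank, given by their singular value decomposition, whose
Schatten norm does not exceed that of `T`. -/
theorem exists_finiteRank_approx (T : H →L[ℂ] H) {p ε : ℝ} (hp : 1 ≤ p) (hε : 0 < ε)
    (htr : posTrace (CFC.abs T ^ p) ≠ ∞) :
    ∃ (n : ℕ) (s : Fin n → ℝ) (e f : Fin n → H), (∀ i, 0 < s i) ∧ Orthonormal ℂ e ∧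
      Orthonormal ℂ f ∧
      ‖T - ∑ i, (s i : ℂ) • InnerProductSpace.rankOne ℂ (e i) (f i)‖ ≤ ε ∧
      ENNReal.ofReal (∑ i, s i ^ p) ≤ posTrace (CFC.abs T ^ p) := by
  set A := CFC.abs T with hA
  have hA0 : 0 ≤ A := CFC.abs_nonneg T
  have hAs : IsSelfAdjoint A := hA0.isSelfAdjoint
  have hspec : ∀ t ∈ spectrum ℝ A, 0 ≤ t := fun t ht => spectrum_nonneg_of_nonneg hA0 ht
  have hApow : (A ^ p).IsPositive :=
    (ContinuousLinearMap.nonneg_iff_isPositive _).1 CFC.rpow_nonneg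
  obtain ⟨B, T', hBpos, hT'B, hnorm, hshift⟩ := exists_softThreshold T hε
  rw [← hA] at hshift
  have hBsymm : ∀ x y, ⟪B x, y⟫_ℂ = ⟪x, B y⟫_ℂ := hBpos.isSymmetric
  set W : Submodule ℂ H := LinearMap.range B.toLinearMap with hW
  -- on the range of `B = (|T| - ε)₊` one has `|T| = ε + B ≥ ε`, so it is finite-dimensional
  have hAW : ∀ x ∈ W, A x = (ε : ℂ) • x + B x := by
    rintro x ⟨y, rfl⟩
    have := congrArg (fun S : H →L[ℂ] H => S y) hshift
    simpa [mul_apply_eq_comp] using this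
  have hlow : ∀ x ∈ W, ‖x‖ = 1 → ε ^ p ≤ RCLike.re ⟪x, (A ^ p) x⟫_ℂ := by
    intro x hx hx1
    refine le_trans ?_ (tangent_le_inner_rpow hA0 hp hε x)
    have h1 : RCLike.re ⟪x, A x⟫_ℂ = ε + RCLike.re ⟪x, B x⟫_ℂ := by
      rw [hAW x hx, inner_add_right, inner_smul_right, inner_self_eq_norm_sq_to_K, hx1]
      simp
    have h2 := hBpos.re_inner_nonneg_right x
    rw [h1, hx1]
    have h3 : 0 ≤ p * ε ^ (p - 1) * RCLike.re ⟪x, B x⟫_ℂ := by positivity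
    nlinarith
  have hcard : ∀ (m : ℕ) (v : Fin m → H), Orthonormal ℂ v → (∀ i, v i ∈ W) →
      m * ENNReal.ofReal (ε ^ p) ≤ posTrace (A ^ p) := by
    intro m v hv hvW
    refine le_trans ?_ (sum_inner_le_posTrace hv hApow)
    calc (m : ℝ≥0∞) * ENNReal.ofReal (ε ^ p) = ∑ i : Fin m, ENNReal.ofReal (ε ^ p) := by simp
      _ ≤ _ := Finset.sum_le_sum fun i _ => ENNReal.ofReal_le_ofReal (hlow _ (hvW i) (hv.1 i))
  have hfin : FiniteDimensional ℂ W := by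
    have hε0 : ENNReal.ofReal (ε ^ p) ≠ 0 := by simp; positivity
    obtain ⟨N, hN⟩ := ENNReal.exists_nat_gt (ENNReal.div_ne_top htr hε0)
    have hrank : Module.rank ℂ W ≤ N := by
      refine rank_le fun s hs => ?_
      by_contra hcon
      set V := Submodule.span ℂ (Set.range fun i : s => ((i : W) : H)) with hV
      have hli : LinearIndependent ℂ (fun i : s => ((i : W) : H)) :=
        hs.map' W.subtype (Submodule.ker_subtype W)
      have hVW : V ≤ W := by
        rw [hV, Submodule.span_le]
        rintro _ ⟨i, rfl⟩
        exact (i : W).2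
      have hdim : Module.finrank ℂ V = s.card := by
        rw [hV, finrank_span_eq_card hli, Fintype.card_coe]
      have : FiniteDimensional ℂ V := FiniteDimensional.span_of_finite ℂ (Set.finite_range _)
      have hon := (stdOrthonormalBasis ℂ V).orthonormal.comp_linearIsometry V.subtypeₗᵢ
      have h1 := hcard _ _ hon fun i => hVW (Subtype.mem _)
      rw [hdim] at h1
      have h2 : (N : ℝ≥0∞) * ENNReal.ofReal (ε ^ p) ≤ posTrace (A ^ p) := by
        refine le_trans ?_ h1
        gcongr
        omega
      rw [ENNReal.div_lt_iff (Or.inl hε0) (Or.inl ENNReal.ofReal_ne_top)] at hN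
      exact absurd hN (not_lt.2 h2)
    exact Module.rank_lt_aleph0_iff.1 (hrank.trans_lt (Cardinal.natCast_lt_aleph0))
  -- an eigenbasis of `B` on its range is a system of right singular vectors of `T'`
  have hinv : ∀ x ∈ W, B.toLinearMap x ∈ W := fun x _ => ⟨x, rfl⟩
  have hsymmW := (hBpos.isSymmetric).restrict_invariant hinv
  set v := hsymmW.eigenvectorBasis rfl with hv
  set β := hsymmW.eigenvalues rfl with hβ
  have hBv : ∀ i, B (v i) = (β i : ℂ) • (v i : H) := fun i => by
    have := congrArg (Subtype.val) (hsymmW.apply_eigenvectorBasis rfl i)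
    exact this
  have hvo : Orthonormal ℂ (fun i => (v i : H)) := v.orthonormal.comp_linearIsometry W.subtypeₗᵢ
  have hker : ∀ x ∈ W, B x = 0 → x = 0 := by
    rintro x ⟨y, rfl⟩ h
    have h1 : ⟪B y, B y⟫_ℂ = 0 := by
      rw [hBsymm]
      change ⟪y, B (B.toLinearMap y)⟫_ℂ = 0
      rw [h, inner_zero_right]
    exact inner_self_eq_zero.1 h1
  have hβ0 : ∀ i, 0 < β i := by
    intro i
    have h1 := hBpos.re_inner_nonneg_right (v i : H)
    rw [hBv, inner_smul_right, inner_self_eq_norm_sq_to_K, hvo.1 i] at h1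
    refine lt_of_le_of_ne (by simpa using h1) fun h0 => ?_
    have h2 := hker _ (v i).2 (by rw [hBv, ← h0]; simp)
    have h3 := hvo.1 i
    simp only [h2, norm_zero] at h3
    exact zero_ne_one h3
  have hTinner : ∀ x y, ⟪T' x, T' y⟫_ℂ = ⟪B x, B y⟫_ℂ := by
    intro x y
    rw [← ContinuousLinearMap.adjoint_inner_right, ← ContinuousLinearMap.star_eq_adjoint, hBsymm]
    have := congrArg (fun S : H →L[ℂ] H => ⟪x, S y⟫_ℂ) hT'B
    simpa [mul_apply_eq_comp] using this
  have hTker : ∀ x, B x = 0 → T' x = 0 := by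
    intro x hx
    have := hTinner x x
    rwa [hx, inner_zero_right, inner_self_eq_zero] at this
  refine ⟨_, β, fun i => ((β i : ℂ)⁻¹) • T' (v i), fun i => v i, hβ0, ?_, hvo, ?_, ?_⟩
  · rw [orthonormal_iff_ite] at hvo ⊢
    intro i j
    rw [inner_smul_left, inner_smul_right, hTinner, hBv, hBv, inner_smul_left, inner_smul_right,
      hvo i j]
    have h1 : (β i : ℂ) ≠ 0 := by exact_mod_cast (hβ0 i).ne'
    have h2 : (β j : ℂ) ≠ 0 := by exact_mod_cast (hβ0 j).ne'
    split_ifs with h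
    · subst h
      simp; field_simp
    · simp
  · refine le_trans (le_of_eq ?_) hnorm
    congr 2
    ext x
    set y : H := x - W.starProjection x with hy
    have hyB : B y = 0 := by
      have h1 : ⟪B (B y), y⟫_ℂ = 0 := Submodule.sub_starProjection_mem_orthogonal x _ ⟨_, rfl⟩
      rw [hBsymm] at h1
      exact inner_self_eq_zero.1 h1
    have hTx : T' x = T' (W.starProjection x) := by
      have h1 := hTker y hyB
      rw [hy, map_sub, sub_eq_zero] at h1
      exact h1
    have hproj : W.starProjection x = ∑ i, ⟪(v i : H), x⟫_ℂ • (v i : H) := by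
      rw [v.starProjection_eq_sum_rankOne]
      simp
    rw [hTx, hproj, map_sum, _root_.sum_apply]
    refine Finset.sum_congr rfl fun i _ => ?_
    have h1 : (β i : ℂ) ≠ 0 := by exact_mod_cast (hβ0 i).ne'
    simp only [map_smul, _root_.smul_apply, InnerProductSpace.rankOne_apply, smul_smul]
    congr 1
    field_simp
  · refine le_trans ?_ (sum_inner_le_posTrace hvo hApow)
    rw [ENNReal.ofReal_sum_of_nonneg fun i _ => Real.rpow_nonneg (hβ0 i).le p]
    refine Finset.sum_le_sum fun i _ => ENNReal.ofReal_le_ofReal ?_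
    refine le_trans ?_ (tangent_le_inner_rpow hA0 hp (hβ0 i) (v i : H))
    have h1 : RCLike.re ⟪(v i : H), A (v i)⟫_ℂ = ε + β i := by
      rw [hAW _ (v i).2, hBv, inner_add_right, inner_smul_right, inner_smul_right,
        inner_self_eq_norm_sq_to_K, hvo.1 i]
      simp
    rw [h1, hvo.1 i]
    have h3 : 0 ≤ p * β i ^ (p - 1) * ε := by
      have := (hβ0 i).le
      positivity
    nlinarith

end SchattenTools

/-! ### Moments of Haar unitaries -/

section HaarMoments

variable {d : ℕ}

instance haarUnitary_isMulLeftInvariant (d : ℕ) : (haarUnitary d).IsMulLeftInvariant := by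
  unfold haarUnitary; infer_instance

theorem continuous_unitary_entry (i j : Fin d) :
    Continuous fun U : Matrix.unitaryGroup (Fin d) ℂ => (U : Matrix (Fin d) (Fin d) ℂ) i j :=
  (continuous_apply_apply i j).comp continuous_subtype_val

theorem Continuous.integrable_haarUnitary {V : Type*} [NormedAddCommGroup V]
    {F : Matrix.unitaryGroup (Fin d) ℂ → V} (hF : Continuous F) :
    Integrable F (haarUnitary d) := by
  refine hF.integrable_of_hasCompactSupport ?_
  exact HasCompactSupport.of_compactSpace F

theorem unitary_sum_col (U : Matrix.unitaryGroup (Fin d) ℂ) (j l : Fin d) :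
    ∑ i, (U : Matrix (Fin d) (Fin d) ℂ) i j * star ((U : Matrix (Fin d) (Fin d) ℂ) i l)
      = if j = l then 1 else 0 := by
  have h := congrFun (congrFun (Matrix.UnitaryGroup.star_mul_self U) l) j
  rw [Matrix.mul_apply, Matrix.one_apply] at h
  simp only [Matrix.star_apply] at h
  simp only [mul_comm _ (star _), h, eq_comm]

/-- The second moment `E[U_{ij} conj U_{kl}]` of the entries of a Haar unitary; the column
indices `j, l` come first, as they are fixed under left translation. -/
noncomputable def haarMoment₂ (j l i k : Fin d) : ℂ :=
  ∫ U : Matrix.unitaryGroup (Fin d) ℂ, (U : Matrix (Fin d) (Fin d) ℂ) i j *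
    star ((U : Matrix (Fin d) (Fin d) ℂ) k l) ∂haarUnitary d

/-- The fourth moment `E[U_{ij} U_{al} conj U_{kp} conj U_{bq}]` of the entries of a Haar
unitary, column indices first. -/
noncomputable def haarMoment₄ (j l p q i a k b : Fin d) : ℂ :=
  ∫ U : Matrix.unitaryGroup (Fin d) ℂ, (U : Matrix (Fin d) (Fin d) ℂ) i j *
    (U : Matrix (Fin d) (Fin d) ℂ) a l * star ((U : Matrix (Fin d) (Fin d) ℂ) k p) *
    star ((U : Matrix (Fin d) (Fin d) ℂ) b q) ∂haarUnitary d

theorem haarMoment₂_invariant (W : Matrix.unitaryGroup (Fin d) ℂ) (j l i k : Fin d) :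
    haarMoment₂ j l i k = ∑ x, ∑ y, (W : Matrix (Fin d) (Fin d) ℂ) i x *
      star ((W : Matrix (Fin d) (Fin d) ℂ) k y) * haarMoment₂ j l x y := by
  have hc := @continuous_unitary_entry d
  rw [haarMoment₂, ← integral_mul_left_eq_self _ W]
  simp only [haarMoment₂, ← integral_const_mul]
  have hint : ∀ x y, Integrable (fun U : Matrix.unitaryGroup (Fin d) ℂ =>
      (W : Matrix (Fin d) (Fin d) ℂ) i x * star ((W : Matrix (Fin d) (Fin d) ℂ) k y) *
      ((U : Matrix (Fin d) (Fin d) ℂ) x j * star ((U : Matrix (Fin d) (Fin d) ℂ) y l)))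
      (haarUnitary d) := fun x y => Continuous.integrable_haarUnitary
        (continuous_const.mul ((hc x j).mul (hc y l).star))
  simp_rw [← integral_finsetSum _ (fun y _ => hint _ y)]
  rw [← integral_finsetSum _ (fun x _ => integrable_finsetSum _ fun y _ => hint x y)]
  congr 1; ext U
  simp only [Matrix.UnitaryGroup.mul_val, Matrix.mul_apply, star_sum, star_mul',
    Finset.sum_mul_sum]
  exact Finset.sum_congr rfl fun x _ => Finset.sum_congr rfl fun y _ => by ring

theorem haarMoment₄_invariant (W : Matrix.unitaryGroup (Fin d) ℂ) (j l p q i a k b : Fin d) :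
    haarMoment₄ j l p q i a k b = ∑ x, ∑ y, ∑ z, ∑ w,
      (W : Matrix (Fin d) (Fin d) ℂ) i x * (W : Matrix (Fin d) (Fin d) ℂ) a y *
      star ((W : Matrix (Fin d) (Fin d) ℂ) k z) * star ((W : Matrix (Fin d) (Fin d) ℂ) b w) *
      haarMoment₄ j l p q x y z w := by
  have hc := @continuous_unitary_entry d
  rw [haarMoment₄, ← integral_mul_left_eq_self _ W]
  simp only [haarMoment₄, ← integral_const_mul]
  have hint : ∀ x y z w, Integrable (fun U : Matrix.unitaryGroup (Fin d) ℂ =>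
      (W : Matrix (Fin d) (Fin d) ℂ) i x * (W : Matrix (Fin d) (Fin d) ℂ) a y *
      star ((W : Matrix (Fin d) (Fin d) ℂ) k z) * star ((W : Matrix (Fin d) (Fin d) ℂ) b w) *
      ((U : Matrix (Fin d) (Fin d) ℂ) x j * (U : Matrix (Fin d) (Fin d) ℂ) y l *
        star ((U : Matrix (Fin d) (Fin d) ℂ) z p) * star ((U : Matrix (Fin d) (Fin d) ℂ) w q)))
      (haarUnitary d) := fun x y z w => Continuous.integrable_haarUnitary
        (continuous_const.mul ((((hc x j).mul (hc y l)).mul (hc z p).star).mul (hc w q).star))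
  simp_rw [← integral_finsetSum _ (fun w _ => hint _ _ _ w)]
  simp_rw [← integral_finsetSum _ (fun z _ => integrable_finsetSum _ fun w _ => hint _ _ z w)]
  simp_rw [← integral_finsetSum _ (fun y _ => integrable_finsetSum _ fun z _ =>
    integrable_finsetSum _ fun w _ => hint _ y z w)]
  rw [← integral_finsetSum _ (fun x _ => integrable_finsetSum _ fun y _ =>
    integrable_finsetSum _ fun z _ => integrable_finsetSum _ fun w _ => hint x y z w)]
  congr 1; ext U
  have hprod : ∀ f g h k : Fin d → ℂ, (∑ x, f x) * (∑ y, g y) * (∑ z, h z) * (∑ w, k w)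
      = ∑ x, ∑ y, ∑ z, ∑ w, f x * g y * h z * k w := fun f g h k => by
    simp only [← Finset.mul_sum, ← Finset.sum_mul]
  simp only [Matrix.UnitaryGroup.mul_val, Matrix.mul_apply, star_sum, star_mul', hprod]
  exact Finset.sum_congr rfl fun x _ => Finset.sum_congr rfl fun y _ =>
    Finset.sum_congr rfl fun z _ => Finset.sum_congr rfl fun w _ => by ring

/-- The diagonal entries of `phaseUnitary c`. -/
noncomputable def phaseEntry (c x : Fin d) : ℂ := if x = c then Complex.I else 1

/-- The diagonal unitary with entry `i` at `c` and `1` elsewhere. -/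
noncomputable def phaseUnitary (c : Fin d) : Matrix.unitaryGroup (Fin d) ℂ :=
  ⟨Matrix.diagonal (phaseEntry c), by
    rw [Matrix.mem_unitaryGroup_iff, Matrix.star_eq_conjTranspose, Matrix.diagonal_conjTranspose,
      Matrix.diagonal_mul_diagonal, ← Matrix.diagonal_one]
    congr 1; ext x
    by_cases h : x = c <;> simp [h, phaseEntry]⟩

/-- The permutation matrix of `σ`. -/
noncomputable def permUnitary (σ : Equiv.Perm (Fin d)) : Matrix.unitaryGroup (Fin d) ℂ :=
  ⟨σ.permMatrix ℂ, by
    rw [Matrix.mem_unitaryGroup_iff, Matrix.star_eq_conjTranspose, Matrix.conjTranspose_permMatrix,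
      ← Matrix.permMatrix_mul]
    simp⟩

/-- The unitary `(1 + i σ) / √2` for the transposition `σ = (c e)`. -/
noncomputable def mixUnitary (c e : Fin d) : Matrix.unitaryGroup (Fin d) ℂ :=
  ⟨((1 / Real.sqrt 2 : ℝ) : ℂ) • (1 + Complex.I • (Equiv.swap c e).permMatrix ℂ), by
    have h1 : (Equiv.swap c e).permMatrix ℂ * (Equiv.swap c e).permMatrix ℂ = 1 := by
      rw [← Matrix.permMatrix_mul, Equiv.swap_mul_self, Matrix.permMatrix_one]
    have h2 : star ((Equiv.swap c e).permMatrix ℂ) = (Equiv.swap c e).permMatrix ℂ := by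
      rw [Matrix.star_eq_conjTranspose, Matrix.conjTranspose_permMatrix, Equiv.swap_inv]
    have h3 : ((1 / Real.sqrt 2 : ℝ) : ℂ) * ((1 / Real.sqrt 2 : ℝ) : ℂ) = 1 / 2 := by
      rw [← Complex.ofReal_mul, div_mul_div_comm, Real.mul_self_sqrt (by norm_num)]
      norm_num
    rw [Matrix.mem_unitaryGroup_iff, star_smul, star_add, star_one, star_smul, h2]
    rw [Matrix.smul_mul, Matrix.mul_smul, smul_smul, RCLike.star_def,
      Complex.conj_ofReal, h3, Complex.conj_I, add_mul, one_mul, mul_add, mul_one, Matrix.smul_mul,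
      Matrix.mul_smul, h1, smul_smul, mul_neg, Complex.I_mul_I]
    module⟩

theorem phaseUnitary_apply (c x y : Fin d) :
    (phaseUnitary c : Matrix (Fin d) (Fin d) ℂ) x y
      = if x = y then phaseEntry c x else 0 := by
  simp [phaseUnitary, Matrix.diagonal_apply]

theorem permUnitary_apply (σ : Equiv.Perm (Fin d)) (x y : Fin d) :
    (permUnitary σ : Matrix (Fin d) (Fin d) ℂ) x y = if σ x = y then 1 else 0 := by
  simp [permUnitary, Equiv.Perm.permMatrix, PEquiv.toMatrix_apply, eq_comm]

theorem mixUnitary_apply_left (c e : Fin d) (y : Fin d) :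
    (mixUnitary c e : Matrix (Fin d) (Fin d) ℂ) c y
      = ((1 / Real.sqrt 2 : ℝ) : ℂ) *
        ((if y = c then 1 else 0) + if y = e then Complex.I else 0) := by
  simp [mixUnitary, Equiv.Perm.permMatrix, PEquiv.toMatrix_apply, Matrix.one_apply, eq_comm,
    mul_add]

/-- Orthogonality of the entries. The phase unitaries kill the moments with `i ≠ k`, and the
permutations show that those with `i = k` do not depend on `i`. -/
theorem haarMoment₂_eq (j l i k : Fin d) :
    haarMoment₂ j l i k = if i = k ∧ j = l then (1 / d : ℂ) else 0 := by
  by_cases hik : i = k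
  · subst hik
    have hperm : ∀ x, haarMoment₂ j l x x = haarMoment₂ j l i i := fun x => by
      rw [haarMoment₂_invariant (permUnitary (Equiv.swap x i))]
      simp [permUnitary_apply]
    have hsum : ∑ x, haarMoment₂ j l x x = if j = l then 1 else 0 := by
      simp only [haarMoment₂]
      rw [← integral_finsetSum]
      · simp only [unitary_sum_col]
        simp
      · exact fun x _ => Continuous.integrable_haarUnitary
          ((continuous_unitary_entry x j).mul (continuous_unitary_entry x l).star)
    simp only [hperm, Finset.sum_const, Finset.card_univ, Fintype.card_fin, nsmul_eq_mul] at hsum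
    have hd : (d : ℂ) ≠ 0 := by
      have := i.pos
      exact_mod_cast this.ne'
    simp only [true_and]
    split_ifs at hsum ⊢ with h
    · field_simp; linear_combination hsum
    · simpa [hd] using hsum
  · rw [if_neg (fun h => hik h.1)]
    have h := haarMoment₂_invariant (phaseUnitary i) j l i k
    simp only [phaseUnitary_apply, apply_ite star, star_zero, mul_ite, ite_mul, mul_zero, zero_mul,
      Finset.sum_ite_eq, Finset.mem_univ, if_true] at h
    simp only [phaseEntry, Ne.symm hik, if_true, if_false, star_one, mul_one] at h
    have h2 : (1 - Complex.I) * haarMoment₂ j l i k = 0 := by linear_combination h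
    refine (mul_eq_zero.1 h2).resolve_left fun h3 => ?_
    have := congrArg Complex.re h3
    simp at this

theorem haarMoment₄_phase (c j l p q i a k b : Fin d) :
    haarMoment₄ j l p q i a k b = phaseEntry c i * phaseEntry c a * star (phaseEntry c k) *
      star (phaseEntry c b) * haarMoment₄ j l p q i a k b := by
  nth_rewrite 1 [haarMoment₄_invariant (phaseUnitary c)]
  simp only [phaseUnitary_apply, apply_ite star, star_zero, mul_ite, ite_mul, mul_zero, zero_mul,
      Finset.sum_ite_eq, Finset.mem_univ, if_true]

theorem haarMoment₄_perm (σ : Equiv.Perm (Fin d)) (j l p q i a k b : Fin d) :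
    haarMoment₄ j l p q (σ i) (σ a) (σ k) (σ b) = haarMoment₄ j l p q i a k b := by
  rw [haarMoment₄_invariant (permUnitary σ) j l p q i a k b]
  simp [permUnitary_apply]

/-- Moments in which the row indices do not match up vanish. -/
theorem haarMoment₄_eq_zero (j l p q : Fin d) {i a k b : Fin d} (h1 : ¬ (i = k ∧ a = b))
    (h2 : ¬ (i = b ∧ a = k)) : haarMoment₄ j l p q i a k b = 0 := by
  -- some index occurs with different multiplicities in `{i, a}` and `{k, b}`
  obtain ⟨c, hc⟩ : ∃ c, phaseEntry c i * phaseEntry c a * star (phaseEntry c k) *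
      star (phaseEntry c b) ≠ 1 := by
    have hI : Complex.I ≠ 1 := fun h => by simpa using congrArg Complex.re h
    have hI' : -Complex.I ≠ 1 := fun h => by simpa using congrArg Complex.re h
    have hI2 : (-1 : ℂ) ≠ 1 := by norm_num
    by_cases hik : i = k
    · refine ⟨a, ?_⟩
      have : b ≠ a := fun h => h1 ⟨hik, h.symm⟩
      subst hik
      by_cases hia : i = a <;> simp [phaseEntry, this, hia, hI]
    · by_cases hib : i = b
      · refine ⟨a, ?_⟩
        have : k ≠ a := fun h => h2 ⟨hib, h.symm⟩
        subst hib
        by_cases hia : i = a <;> simp [phaseEntry, this, hia, hI]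
      · refine ⟨i, ?_⟩
        by_cases hia : a = i <;> simp [phaseEntry, Ne.symm hik, Ne.symm hib, hia, hI, hI2]
  have h := haarMoment₄_phase c j l p q i a k b
  have h3 : (1 - phaseEntry c i * phaseEntry c a * star (phaseEntry c k) *
      star (phaseEntry c b)) * haarMoment₄ j l p q i a k b = 0 := by linear_combination h
  exact (mul_eq_zero.1 h3).resolve_left fun h4 => hc (sub_eq_zero.1 h4).symm

/-- Invariance under `mixUnitary c e` ties the moments with four equal row indices to the two
pairings. -/
theorem haarMoment₄_diag (j l p q : Fin d) {c e : Fin d} (hce : c ≠ e) :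
    haarMoment₄ j l p q c c c c
      = haarMoment₄ j l p q c e c e + haarMoment₄ j l p q c e e c := by
  have hs : ((1 / Real.sqrt 2 : ℝ) : ℂ) ^ 2 = 1 / 2 := by
    rw [← Complex.ofReal_pow, div_pow, Real.sq_sqrt (by norm_num)]
    norm_num
  have hstar : ∀ y : Fin d, star (((1 / Real.sqrt 2 : ℝ) : ℂ) *
      ((if y = c then 1 else 0) + if y = e then Complex.I else 0))
      = ((1 / Real.sqrt 2 : ℝ) : ℂ) *
        ((if y = c then 1 else 0) + if y = e then -Complex.I else 0) := by
    intro y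
    rw [star_mul', star_add, apply_ite star, apply_ite star]
    simp
  have h := haarMoment₄_invariant (mixUnitary c e) j l p q c c c c
  simp only [mixUnitary_apply_left, hstar] at h
  generalize ((1 / Real.sqrt 2 : ℝ) : ℂ) = r at h hs
  simp only [mul_add, add_mul, Finset.sum_add_distrib, mul_ite, ite_mul, mul_zero, zero_mul,
    Finset.sum_ite_eq', Finset.mem_univ, if_true, mul_one] at h
  have hz := fun (i a k b : Fin d) h1 h2 => haarMoment₄_eq_zero j l p q (i := i) (a := a) (k := k)
    (b := b) h1 h2
  have hec := hce.symm
  rw [hz e c c c (by tauto) (by tauto), hz c e c c (by tauto) (by tauto),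
    hz e e c c (by tauto) (by tauto), hz c c e c (by tauto) (by tauto),
    hz e e e c (by tauto) (by tauto), hz c c c e (by tauto) (by tauto),
    hz e e c e (by tauto) (by tauto), hz c c e e (by tauto) (by tauto),
    hz e c e e (by tauto) (by tauto), hz c e e e (by tauto) (by tauto)] at h
  have hp := haarMoment₄_perm (Equiv.swap c e) j l p q
  have hp1 := hp c c c c
  have hp2 := hp c e c e
  have hp3 := hp c e e c
  simp only [Equiv.swap_apply_left, Equiv.swap_apply_right] at hp1 hp2 hp3
  rw [hp1, hp2, hp3] at h
  have h' : haarMoment₄ j l p q c c c c = (r ^ 2) ^ 2 * (haarMoment₄ j l p q c c c c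
      + (Complex.I ^ 2) ^ 2 * haarMoment₄ j l p q c c c c
      - Complex.I ^ 2 * (2 * haarMoment₄ j l p q c e c e + 2 * haarMoment₄ j l p q c e e c)) := by
    linear_combination h
  rw [hs, Complex.I_sq] at h'
  linear_combination 2 * h'

/-- The Kronecker delta. -/
def kroneckerDelta (x y : Fin d) : ℂ := if x = y then 1 else 0

/-- Invariance of the fourth moments under the unitary group forces them to be combinations of the
two pairings of the row indices. -/
theorem exists_haarMoment₄_eq (hd : 2 ≤ d) (j l p q : Fin d) : ∃ α β : ℂ, ∀ i a k b,
    haarMoment₄ j l p q i a k b = α * (kroneckerDelta i k * kroneckerDelta a b)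
      + β * (kroneckerDelta i b * kroneckerDelta a k) := by
  obtain ⟨x, y, hxy⟩ : ∃ x y : Fin d, x ≠ y :=
    ⟨⟨0, by omega⟩, ⟨1, by omega⟩, by simp⟩
  have htrans : ∀ i a : Fin d, i ≠ a → ∃ σ : Equiv.Perm (Fin d), σ x = i ∧ σ y = a := by
    intro i a hia
    have h1 : Equiv.swap x i y ≠ i := fun h => hxy <| by
      rw [← (Equiv.swap x i).injective.eq_iff, h, Equiv.swap_apply_left]
    refine ⟨Equiv.swap (Equiv.swap x i y) a * Equiv.swap x i, ?_, ?_⟩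
    · rw [Equiv.Perm.mul_apply, Equiv.swap_apply_left, Equiv.swap_apply_of_ne_of_ne h1.symm hia]
    · rw [Equiv.Perm.mul_apply, Equiv.swap_apply_left]
  have hone : ∀ i : Fin d, haarMoment₄ j l p q i i i i
      = haarMoment₄ j l p q x y x y + haarMoment₄ j l p q x y y x := by
    intro i
    rw [← haarMoment₄_diag j l p q hxy]
    have := haarMoment₄_perm (Equiv.swap x i) j l p q x x x x
    rwa [Equiv.swap_apply_left] at this
  refine ⟨haarMoment₄ j l p q x y x y, haarMoment₄ j l p q x y y x, fun i a k b => ?_⟩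
  by_cases h1 : i = k ∧ a = b
  · obtain ⟨rfl, rfl⟩ := h1
    by_cases hia : i = a
    · subst hia
      simp [kroneckerDelta, hone]
    · obtain ⟨σ, rfl, rfl⟩ := htrans i a hia
      rw [haarMoment₄_perm]
      simp [kroneckerDelta, hxy]
  · by_cases h2 : i = b ∧ a = k
    · obtain ⟨rfl, rfl⟩ := h2
      have hia : i ≠ a := fun h => h1 ⟨h, h.symm⟩
      obtain ⟨σ, rfl, rfl⟩ := htrans i a hia
      rw [haarMoment₄_perm]
      simp [kroneckerDelta, hxy]
    · rw [haarMoment₄_eq_zero j l p q h1 h2]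
      have e1 : kroneckerDelta i k * kroneckerDelta a b = 0 := by
        by_cases h : i = k
        · have : a ≠ b := fun h' => h1 ⟨h, h'⟩
          simp [kroneckerDelta, this]
        · simp [kroneckerDelta, h]
      have e2 : kroneckerDelta i b * kroneckerDelta a k = 0 := by
        by_cases h : i = b
        · have : a ≠ k := fun h' => h2 ⟨h, h'⟩
          simp [kroneckerDelta, this]
        · simp [kroneckerDelta, h]
      rw [e1, e2]; simp

theorem integral_mul_unitary_sum_col (j l p q : Fin d) :
    ∑ i, ∑ a, haarMoment₄ j l p q i a i a = kroneckerDelta j p * kroneckerDelta l q := by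
  have hc := @continuous_unitary_entry d
  simp only [haarMoment₄]
  have hint : ∀ i a, Integrable (fun U : Matrix.unitaryGroup (Fin d) ℂ =>
      ((U : Matrix (Fin d) (Fin d) ℂ) i j * (U : Matrix (Fin d) (Fin d) ℂ) a l *
        star ((U : Matrix (Fin d) (Fin d) ℂ) i p) * star ((U : Matrix (Fin d) (Fin d) ℂ) a q)))
      (haarUnitary d) := fun i a => Continuous.integrable_haarUnitary
        ((((hc i j).mul (hc a l)).mul (hc i p).star).mul (hc a q).star)
  simp_rw [← integral_finsetSum _ (fun a _ => hint _ a)]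
  rw [← integral_finsetSum _ (fun i _ => integrable_finsetSum _ fun a _ => hint i a)]
  have : ∀ U : Matrix.unitaryGroup (Fin d) ℂ, ∑ i, ∑ a, (U : Matrix (Fin d) (Fin d) ℂ) i j *
      (U : Matrix (Fin d) (Fin d) ℂ) a l * star ((U : Matrix (Fin d) (Fin d) ℂ) i p) *
      star ((U : Matrix (Fin d) (Fin d) ℂ) a q) = kroneckerDelta j p * kroneckerDelta l q := by
    intro U
    rw [kroneckerDelta, kroneckerDelta, ← unitary_sum_col U j p, ← unitary_sum_col U l q,
      Finset.sum_mul_sum]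
    exact Finset.sum_congr rfl fun _ _ => Finset.sum_congr rfl fun _ _ => by ring
  simp only [this]
  simp

theorem haarMoment₄_swap (j l p q i a k b : Fin d) :
    haarMoment₄ j l p q i a k b = haarMoment₄ j l q p i a b k := by
  simp only [haarMoment₄]
  congr 1; ext U; ring

/-- The Weingarten formula of order two. The two coefficients in `exists_haarMoment₄_eq` are
determined by summing over the rows, where unitarity gives the values. -/
theorem haarMoment₄_eq (hd : 2 ≤ d) (j l p q i a k b : Fin d) :
    haarMoment₄ j l p q i a k b = 1 / ((d : ℂ) ^ 2 - 1) *
        ((kroneckerDelta i k * kroneckerDelta a b) * (kroneckerDelta j p * kroneckerDelta l q)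
          + (kroneckerDelta i b * kroneckerDelta a k) * (kroneckerDelta j q * kroneckerDelta l p))
      - 1 / (d * ((d : ℂ) ^ 2 - 1)) *
        ((kroneckerDelta i k * kroneckerDelta a b) * (kroneckerDelta j q * kroneckerDelta l p)
          + (kroneckerDelta i b * kroneckerDelta a k) * (kroneckerDelta j p * kroneckerDelta l q))
      := by
  obtain ⟨α, β, h⟩ := exists_haarMoment₄_eq hd j l p q
  have h1 := integral_mul_unitary_sum_col j l p q
  have h2 := integral_mul_unitary_sum_col j l q p
  simp only [← haarMoment₄_swap j l p q] at h2
  simp only [h] at h1 h2 ⊢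
  have s1 : ∑ i : Fin d, kroneckerDelta i i = (d : ℂ) := by simp [kroneckerDelta]
  have s2 : ∑ i : Fin d, ∑ a : Fin d, (kroneckerDelta i a * kroneckerDelta a i) = (d : ℂ) := by
    simp [kroneckerDelta]
  simp only [Finset.sum_add_distrib, ← Finset.mul_sum, ← Finset.sum_mul, s1, s2] at h1 h2
  have hd0 : (d : ℂ) ≠ 0 := by
    have : d ≠ 0 := by omega
    exact_mod_cast this
  have hd1 : (d : ℂ) ^ 2 - 1 ≠ 0 := by
    have h4 : (4 : ℝ) ≤ (d : ℝ) ^ 2 := by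
      have : (2 : ℝ) ≤ d := by exact_mod_cast hd
      nlinarith
    intro h3
    have h5 : (d : ℝ) ^ 2 - 1 = 0 := by exact_mod_cast h3
    linarith
  rw [← h1, ← h2]
  field_simp
  ring

/-- The centred matrix coefficients `d U_q conj U_{q'} - δ_{qq'}` of `Θ`. -/
noncomputable def thetaCoeff (U : Matrix.unitaryGroup (Fin d) ℂ) (q q' : Fin d × Fin d) : ℂ :=
  d * ((U : Matrix (Fin d) (Fin d) ℂ) q.1 q.2 * star ((U : Matrix (Fin d) (Fin d) ℂ) q'.1 q'.2))
    - if q = q' then 1 else 0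

theorem integral_normSq_quadratic (A : Fin d × Fin d → Fin d × Fin d → ℂ) :
    ∫ U : Matrix.unitaryGroup (Fin d) ℂ, (∑ x, ∑ y, A x y *
      ((U : Matrix (Fin d) (Fin d) ℂ) x.1 x.2 * star ((U : Matrix (Fin d) (Fin d) ℂ) y.1 y.2))) *
      star (∑ x, ∑ y, A x y * ((U : Matrix (Fin d) (Fin d) ℂ) x.1 x.2 *
        star ((U : Matrix (Fin d) (Fin d) ℂ) y.1 y.2))) ∂haarUnitary d
    = ∑ x, ∑ y, ∑ z, ∑ w, A x y * star (A z w) *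
        haarMoment₄ x.2 w.2 y.2 z.2 x.1 w.1 y.1 z.1 := by
  have hc := @continuous_unitary_entry d
  simp only [haarMoment₄, ← integral_const_mul]
  have hint : ∀ x y z w : Fin d × Fin d, Integrable (fun U : Matrix.unitaryGroup (Fin d) ℂ =>
      A x y * star (A z w) *
      ((U : Matrix (Fin d) (Fin d) ℂ) x.1 x.2 * (U : Matrix (Fin d) (Fin d) ℂ) w.1 w.2 *
        star ((U : Matrix (Fin d) (Fin d) ℂ) y.1 y.2) *
        star ((U : Matrix (Fin d) (Fin d) ℂ) z.1 z.2)))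
      (haarUnitary d) := fun x y z w => Continuous.integrable_haarUnitary
        (continuous_const.mul ((((hc _ _).mul (hc _ _)).mul (hc _ _).star).mul (hc _ _).star))
  simp_rw [← integral_finsetSum _ (fun w _ => hint _ _ _ w)]
  simp_rw [← integral_finsetSum _ (fun z _ => integrable_finsetSum _ fun w _ => hint _ _ z w)]
  simp_rw [← integral_finsetSum _ (fun y _ => integrable_finsetSum _ fun z _ =>
    integrable_finsetSum _ fun w _ => hint _ y z w)]
  rw [← integral_finsetSum _ (fun x _ => integrable_finsetSum _ fun y _ =>
    integrable_finsetSum _ fun z _ => integrable_finsetSum _ fun w _ => hint x y z w)]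
  congr 1; ext U
  simp only [star_sum, star_mul', star_star]
  rw [Finset.sum_mul]
  refine Finset.sum_congr rfl fun x _ => ?_
  rw [Finset.sum_mul]
  refine Finset.sum_congr rfl fun y _ => ?_
  rw [Finset.mul_sum]
  refine Finset.sum_congr rfl fun z _ => ?_
  rw [Finset.mul_sum]
  exact Finset.sum_congr rfl fun w _ => by ring

/-- The four contractions of `A ⊗ A†` in the Weingarten formula: the squared modulus of the trace,
the squared Hilbert-Schmidt norm, and those of the two partial traces. -/
theorem sum_pairing_eq (A : Fin d × Fin d → Fin d × Fin d → ℂ) :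
    (∑ x, ∑ y, ∑ z, ∑ w, A x y * star (A z w) *
        ((kroneckerDelta x.1 y.1 * kroneckerDelta w.1 z.1) *
          (kroneckerDelta x.2 y.2 * kroneckerDelta w.2 z.2)) = (∑ x, A x x) * star (∑ x, A x x)) ∧
    (∑ x, ∑ y, ∑ z, ∑ w, A x y * star (A z w) *
        ((kroneckerDelta x.1 z.1 * kroneckerDelta w.1 y.1) *
          (kroneckerDelta x.2 z.2 * kroneckerDelta w.2 y.2)) = ∑ x, ∑ y, A x y * star (A x y)) ∧
    (∑ x, ∑ y, ∑ z, ∑ w, A x y * star (A z w) *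
        ((kroneckerDelta x.1 y.1 * kroneckerDelta w.1 z.1) *
          (kroneckerDelta x.2 z.2 * kroneckerDelta w.2 y.2))
      = ∑ j, ∑ p, (∑ i, A (i, j) (i, p)) * star (∑ i, A (i, j) (i, p))) ∧
    (∑ x, ∑ y, ∑ z, ∑ w, A x y * star (A z w) *
        ((kroneckerDelta x.1 z.1 * kroneckerDelta w.1 y.1) *
          (kroneckerDelta x.2 y.2 * kroneckerDelta w.2 z.2))
      = ∑ i, ∑ k, (∑ j, A (i, j) (k, j)) * star (∑ j, A (i, j) (k, j))) := by
  have hk : ∀ x y : Fin d × Fin d, kroneckerDelta x.1 y.1 * kroneckerDelta x.2 y.2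
      = if x = y then 1 else 0 := fun x y => by
    simp only [kroneckerDelta, Prod.ext_iff]
    split_ifs <;> simp_all
  refine ⟨?_, ?_, ?_, ?_⟩
  · have : ∀ x y z w : Fin d × Fin d, A x y * star (A z w) *
        ((kroneckerDelta x.1 y.1 * kroneckerDelta w.1 z.1) *
          (kroneckerDelta x.2 y.2 * kroneckerDelta w.2 z.2))
        = (A x y * if x = y then 1 else 0) * (star (A z w) * if w = z then 1 else 0) := by
      intro x y z w; rw [← hk, ← hk]; ring
    simp only [this, ← Finset.mul_sum, ← Finset.sum_mul]
    simp
  · have : ∀ x y z w : Fin d × Fin d, A x y * star (A z w) *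
        ((kroneckerDelta x.1 z.1 * kroneckerDelta w.1 y.1) *
          (kroneckerDelta x.2 z.2 * kroneckerDelta w.2 y.2))
        = A x y * star (A z w) * (if x = z then 1 else 0) * (if w = y then 1 else 0) := by
      intro x y z w; rw [← hk, ← hk]; ring
    simp only [this]
    simp
  · simp only [star_sum, Finset.sum_mul_sum, Fintype.sum_prod_type, kroneckerDelta, mul_ite,
      mul_one, mul_zero, Finset.sum_ite_eq', Finset.mem_univ, if_true]
    simp
    rw [Finset.sum_comm]
    exact Finset.sum_congr rfl fun _ _ => Finset.sum_comm
  · simp only [star_sum, Finset.sum_mul_sum, Fintype.sum_prod_type, kroneckerDelta, mul_ite,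
      mul_one, mul_zero, Finset.sum_ite_eq', Finset.mem_univ, if_true]
    simp
    exact Finset.sum_congr rfl fun _ _ => Finset.sum_comm

/-- The decoupling map minus its mean is bounded from `S_2` to `L_2`, with norm at most
`d / √(d² - 1) ≤ 2 / √3`. -/
theorem integral_norm_sq_thetaCoeff_le (A : Fin d × Fin d → Fin d × Fin d → ℂ) :
    ∫ U : Matrix.unitaryGroup (Fin d) ℂ, ‖∑ x, ∑ y, A x y * thetaCoeff U x y‖ ^ 2 ∂haarUnitary d
      ≤ 4 / 3 * ∑ x, ∑ y, ‖A x y‖ ^ 2 := by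
  have hpos : 0 ≤ 4 / 3 * ∑ x, ∑ y, ‖A x y‖ ^ 2 := by positivity
  -- for `d = 1` the Weingarten formula is singular, but the coefficients vanish
  rcases (by omega : d = 0 ∨ d = 1 ∨ 2 ≤ d) with rfl | rfl | hd
  · simp
  · have : ∀ (U : Matrix.unitaryGroup (Fin 1) ℂ) x y, thetaCoeff U x y = 0 := by
      intro U x y
      have h := unitary_sum_col U 0 0
      simp only [Finset.univ_unique, Fin.default_eq_zero, Finset.sum_singleton, if_true] at h
      rw [thetaCoeff, Subsingleton.elim x (0, 0), Subsingleton.elim y (0, 0), h]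
      simp
    simpa [this] using hpos
  set M : Matrix.unitaryGroup (Fin d) ℂ → ℂ := fun U => ∑ x, ∑ y, A x y *
      ((U : Matrix (Fin d) (Fin d) ℂ) x.1 x.2 * star ((U : Matrix (Fin d) (Fin d) ℂ) y.1 y.2))
    with hM
  set T := ∑ x, A x x with hT
  have hd0 : (d : ℂ) ≠ 0 := by
    have : d ≠ 0 := by omega
    exact_mod_cast this
  have hc := @continuous_unitary_entry d
  have hMc : Continuous M := by
    refine continuous_finsetSum _ fun x _ => continuous_finsetSum _ fun y _ => ?_
    exact continuous_const.mul ((hc _ _).mul (hc _ _).star)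
  have hdM : ∀ U, ∑ x, ∑ y, A x y * thetaCoeff U x y = d * M U - T := by
    intro U
    simp only [thetaCoeff, mul_sub, Finset.sum_sub_distrib, hM, hT, Finset.mul_sum]
    congr 1
    · exact Finset.sum_congr rfl fun x _ => Finset.sum_congr rfl fun y _ => by ring
    · simp
  have hEM : ∫ U, M U ∂haarUnitary d = T / d := by
    have hint : ∀ x y : Fin d × Fin d, Integrable (fun U : Matrix.unitaryGroup (Fin d) ℂ => A x y *
        ((U : Matrix (Fin d) (Fin d) ℂ) x.1 x.2 * star ((U : Matrix (Fin d) (Fin d) ℂ) y.1 y.2)))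
        (haarUnitary d) := fun x y => Continuous.integrable_haarUnitary
          (continuous_const.mul ((hc _ _).mul (hc _ _).star))
    rw [hM, integral_finsetSum _ (fun x _ => integrable_finsetSum _ fun y _ => hint x y)]
    simp_rw [integral_finsetSum _ (fun y _ => hint _ y), integral_const_mul]
    have h2 : ∀ x y : Fin d × Fin d, ∫ U : Matrix.unitaryGroup (Fin d) ℂ,
        (U : Matrix (Fin d) (Fin d) ℂ) x.1 x.2 * star ((U : Matrix (Fin d) (Fin d) ℂ) y.1 y.2)
          ∂haarUnitary d = if x = y then (1 / d : ℂ) else 0 := fun x y => by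
      have := haarMoment₂_eq x.2 y.2 x.1 y.1
      rw [haarMoment₂] at this
      simp only [this, Prod.ext_iff]
    simp only [h2, mul_ite, mul_zero, Finset.sum_ite_eq, Finset.mem_univ, if_true, hT,
      Finset.sum_div, mul_one_div]
  have hEM' : ∫ U, star (M U) ∂haarUnitary d = star T / d := by
    have := integral_conj (f := M) (μ := haarUnitary d)
    rw [hEM] at this
    simpa using this
  set S := ∑ x, ∑ y, ‖A x y‖ ^ 2 with hS
  set S₃ := ∑ j, ∑ p, ‖∑ i, A (i, j) (i, p)‖ ^ 2 with hS₃
  set S₄ := ∑ i, ∑ k, ‖∑ j, A (i, j) (k, j)‖ ^ 2 with hS₄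
  have hEMM : ∫ U, M U * star (M U) ∂haarUnitary d
      = ((1 / ((d : ℝ) ^ 2 - 1) * (‖T‖ ^ 2 + S) - 1 / (d * ((d : ℝ) ^ 2 - 1)) * (S₃ + S₄) : ℝ) : ℂ)
      := by
    have hnn : ∀ z : ℂ, z * star z = ((‖z‖ ^ 2 : ℝ) : ℂ) := fun z => by
      rw [RCLike.star_def, Complex.mul_conj, Complex.normSq_eq_norm_sq]
    obtain ⟨p1, p2, p3, p4⟩ := sum_pairing_eq A
    rw [hM, integral_normSq_quadratic]
    simp only [haarMoment₄_eq hd]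
    have hring : ∀ (u w1 w2 a b c e : ℂ), u * (w1 * (a + b) - w2 * (c + e))
        = w1 * (u * a) + w1 * (u * b) - w2 * (u * c) - w2 * (u * e) := by intros; ring
    simp only [hring, Finset.sum_add_distrib, Finset.sum_sub_distrib, ← Finset.mul_sum]
    rw [p1, p2, p3, p4]
    rw [hT, hS, hS₃, hS₄]
    simp only [hnn]
    push_cast
    ring
  have hint : ∫ U, ‖∑ x, ∑ y, A x y * thetaCoeff U x y‖ ^ 2 ∂haarUnitary d
      = (d : ℝ) ^ 2 * (1 / ((d : ℝ) ^ 2 - 1) * (‖T‖ ^ 2 + S)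
        - 1 / (d * ((d : ℝ) ^ 2 - 1)) * (S₃ + S₄)) - ‖T‖ ^ 2 := by
    have hnn : ∀ z : ℂ, ((‖z‖ ^ 2 : ℝ) : ℂ) = z * star z := fun z => by
      rw [RCLike.star_def, Complex.mul_conj, Complex.normSq_eq_norm_sq]
    have : ∫ U, ((‖d * M U - T‖ ^ 2 : ℝ) : ℂ) ∂haarUnitary d
        = (d : ℂ) ^ 2 * ∫ U, M U * star (M U) ∂haarUnitary d - T * star T := by
      have h1 : ∀ U, ((‖d * M U - T‖ ^ 2 : ℝ) : ℂ) = (d : ℂ) ^ 2 * (M U * star (M U))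
          - (d * star T) * M U - (d * T) * star (M U) + T * star T := by
        intro U
        rw [hnn, star_sub, star_mul', star_natCast]
        ring
      simp only [h1]
      have i1 : Integrable (fun U => (d : ℂ) ^ 2 * (M U * star (M U))) (haarUnitary d) :=
        Continuous.integrable_haarUnitary (continuous_const.mul (hMc.mul hMc.star))
      have i2 : Integrable (fun U => (d * star T) * M U) (haarUnitary d) :=
        Continuous.integrable_haarUnitary (continuous_const.mul hMc)
      have i3 : Integrable (fun U => (d * T) * star (M U)) (haarUnitary d) :=
        Continuous.integrable_haarUnitary (continuous_const.mul hMc.star)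
      have i12 : Integrable (fun U => (d : ℂ) ^ 2 * (M U * star (M U)) - (d * star T) * M U)
        (haarUnitary d) := i1.sub i2
      have i123 : Integrable (fun U => (d : ℂ) ^ 2 * (M U * star (M U)) - (d * star T) * M U
        - (d * T) * star (M U)) (haarUnitary d) := i12.sub i3
      rw [integral_add i123 (integrable_const _), integral_sub i12 i3,
        integral_sub i1 i2, integral_const_mul, integral_const_mul, integral_const_mul, hEM, hEM']
      simp only [integral_const, probReal_univ, one_smul]
      field_simp
      ring
    rw [hEMM, ← hnn T, integral_complex_ofReal] at this
    simp only [hdM]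
    exact_mod_cast this
  rw [hint]
  have hdr : (2 : ℝ) ≤ d := by exact_mod_cast hd
  have hd1 : (0 : ℝ) < (d : ℝ) ^ 2 - 1 := by nlinarith
  have hcs : ∀ u : Fin d → ℂ, ‖∑ i, u i‖ ^ 2 ≤ d * ∑ i, ‖u i‖ ^ 2 := fun u => by
    calc ‖∑ i, u i‖ ^ 2 ≤ (∑ i, ‖u i‖) ^ 2 := by gcongr; exact norm_sum_le _ _
      _ ≤ _ := by simpa using sq_sum_le_card_mul_sum_sq (s := Finset.univ) (f := fun i => ‖u i‖)
  -- the partial traces dominate the trace, which removes `‖T‖²` from the variance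
  have h3 : ‖T‖ ^ 2 ≤ d * S₃ := by
    have h1 : T = ∑ j, ∑ i, A (i, j) (i, j) := by
      rw [hT, Fintype.sum_prod_type, Finset.sum_comm]
    rw [h1]
    refine (hcs _).trans ?_
    rw [hS₃]
    refine mul_le_mul_of_nonneg_left (Finset.sum_le_sum fun j _ => ?_) (Nat.cast_nonneg d)
    exact Finset.single_le_sum (f := fun p => ‖∑ i, A (i, j) (i, p)‖ ^ 2)
      (fun p _ => by positivity) (Finset.mem_univ j)
  have h4 : ‖T‖ ^ 2 ≤ d * S₄ := by
    have h1 : T = ∑ i, ∑ j, A (i, j) (i, j) := by rw [hT, Fintype.sum_prod_type]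
    rw [h1]
    refine (hcs _).trans ?_
    rw [hS₄]
    refine mul_le_mul_of_nonneg_left (Finset.sum_le_sum fun i _ => ?_) (Nat.cast_nonneg d)
    exact Finset.single_le_sum (f := fun k => ‖∑ j, A (i, j) (k, j)‖ ^ 2)
      (fun p _ => by positivity) (Finset.mem_univ i)
  have hS0 : 0 ≤ S := by positivity
  have hT0 : 0 ≤ ‖T‖ ^ 2 := by positivity
  have e : (d : ℝ) ^ 2 * (1 / ((d : ℝ) ^ 2 - 1) * (‖T‖ ^ 2 + S)
        - 1 / (d * ((d : ℝ) ^ 2 - 1)) * (S₃ + S₄)) - ‖T‖ ^ 2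
      = ((d : ℝ) ^ 2 * S + ‖T‖ ^ 2 - d * S₃ - d * S₄) / ((d : ℝ) ^ 2 - 1) := by
    field_simp; ring
  rw [e, div_le_iff₀ hd1]
  have h5 : 4 * S ≤ (d : ℝ) ^ 2 * S := by
    gcongr; nlinarith
  nlinarith

end HaarMoments

/-! ### Block form of the decoupling map and the endpoint `α = 1` -/

section Blocks

variable {d : ℕ} {R : Type*} [NormedAddCommGroup R] [InnerProductSpace ℂ R]

omit [InnerProductSpace ℂ R] in
theorem AATensor.norm_sq_eq (x : AATensor d R) : ‖x‖ ^ 2 = ∑ q, ‖x q‖ ^ 2 :=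
  PiLp.norm_sq_eq_of_L2 _ x

variable [CompleteSpace R]

/-- The block `Y_{q q'} = ⟨q| Y |q'⟩` of an operator on `A' ⊗ A ⊗ R`. -/
noncomputable def AATensor.block (Y : AATensor d R →L[ℂ] AATensor d R) (q q' : Fin d × Fin d) :
    R →L[ℂ] R :=
  PiLp.proj 2 (fun _ : Fin d × Fin d => R) q ∘L Y ∘L
    ContinuousLinearMap.adjoint (PiLp.proj 2 (fun _ : Fin d × Fin d => R) q' :
      AATensor d R →L[ℂ] R)

theorem AATensor.adjoint_proj_apply (q q' : Fin d × Fin d) (u : R) :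
    ContinuousLinearMap.adjoint (PiLp.proj 2 (fun _ : Fin d × Fin d => R) q' :
      AATensor d R →L[ℂ] R) u q = if q = q' then u else 0 := by
  have h : ContinuousLinearMap.adjoint (PiLp.proj 2 (fun _ : Fin d × Fin d => R) q' :
      AATensor d R →L[ℂ] R) u = WithLp.toLp 2 (fun q => if q = q' then u else 0) := by
    refine ext_inner_left ℂ fun z => ?_
    rw [ContinuousLinearMap.adjoint_inner_right, PiLp.inner_apply]
    simp [apply_ite]
  rw [h]

theorem AATensor.block_onR (a b : R →L[ℂ] R) (Z : AATensor d R →L[ℂ] AATensor d R)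
    (q q' : Fin d × Fin d) :
    block (onR d a ∘L Z ∘L onR d b) q q' = a ∘L block Z q q' ∘L b := by
  ext u
  have h : onR d b (ContinuousLinearMap.adjoint (PiLp.proj 2 (fun _ : Fin d × Fin d => R) q' :
      AATensor d R →L[ℂ] R) u) = ContinuousLinearMap.adjoint
      (PiLp.proj 2 (fun _ : Fin d × Fin d => R) q' : AATensor d R →L[ℂ] R) (b u) := by
    ext q
    simp only [onR, AATensor.mk_apply, ContinuousLinearMap.comp_apply, PiLp.proj_apply,
      AATensor.adjoint_proj_apply]
    split_ifs <;> simp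
  simp only [block, ContinuousLinearMap.comp_apply, h]
  rfl

theorem AATensor.block_rankOne (x y : AATensor d R) (q q' : Fin d × Fin d) :
    block (InnerProductSpace.rankOne ℂ x y) q q' = InnerProductSpace.rankOne ℂ (x q) (y q') := by
  ext u
  simp only [block, ContinuousLinearMap.comp_apply, InnerProductSpace.rankOne_apply,
    ContinuousLinearMap.adjoint_inner_right]
  rfl

theorem AATensor.block_sum_smul {n : ℕ} (r : Fin n → ℂ)
    (Y : Fin n → AATensor d R →L[ℂ] AATensor d R) (q q' : Fin d × Fin d) :
    block (∑ k, r k • Y k) q q' = ∑ k, r k • block (Y k) q q' := by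
  ext u
  simp only [block, ContinuousLinearMap.comp_apply, _root_.sum_apply, _root_.smul_apply, map_sum,
    map_smul]

theorem AATensor.continuous_block (q q' : Fin d × Fin d) :
    Continuous fun Y : AATensor d R →L[ℂ] AATensor d R => block Y q q' := by
  unfold block
  fun_prop

/-- The operator `⟨Φ| U_A` is `d^{-1/2} ∑ q, U_q ⟨q|`, as `|Φ⟩` pairs the two factors `ℂ^d`. -/
theorem theta_eq_sum_block (Y : AATensor d R →L[ℂ] AATensor d R)
    (U : Matrix.unitaryGroup (Fin d) ℂ) :
    Theta Y U = ∑ q, ∑ q', (d * ((U : Matrix (Fin d) (Fin d) ℂ) q.1 q.2 *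
      star ((U : Matrix (Fin d) (Fin d) ℂ) q'.1 q'.2))) • AATensor.block Y q q' := by
  set P : Fin d × Fin d → AATensor d R →L[ℂ] R :=
    fun q => PiLp.proj 2 (fun _ : Fin d × Fin d => R) q with hP
  have hL : ContinuousLinearMap.adjoint (ketPhi d R) ∘L onA R (U : Matrix (Fin d) (Fin d) ℂ)
      = ((1 / Real.sqrt d : ℝ) : ℂ) • ∑ q, (U : Matrix (Fin d) (Fin d) ℂ) q.1 q.2 • P q := by
    ext x
    refine ext_inner_left ℂ fun g => ?_
    rw [ContinuousLinearMap.comp_apply, ContinuousLinearMap.adjoint_inner_right, ketPhi,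
      _root_.smul_apply, inner_smul_left, Complex.conj_ofReal, _root_.smul_apply, inner_smul_right,
      PiLp.inner_apply]
    congr 1
    simp only [AATensor.mk_apply, onA, _root_.sum_apply, _root_.smul_apply, inner_sum,
      Fintype.sum_prod_type, hP, PiLp.proj_apply]
    refine Finset.sum_congr rfl fun i _ => ?_
    rw [Finset.sum_eq_single i]
    · simp
    · intro j _ hj
      simp [Ne.symm hj]
    · simp
  have hTh : Theta Y U = ((d : ℂ) ^ 2) • ((ContinuousLinearMap.adjoint (ketPhi d R) ∘L
      onA R (U : Matrix (Fin d) (Fin d) ℂ)) ∘L Y ∘L ContinuousLinearMap.adjoint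
      (ContinuousLinearMap.adjoint (ketPhi d R) ∘L onA R (U : Matrix (Fin d) (Fin d) ℂ))) := by
    rw [ContinuousLinearMap.adjoint_comp, ContinuousLinearMap.adjoint_adjoint]
    rfl
  have hd : (d : ℂ) ^ 2 * (((1 / Real.sqrt d : ℝ) : ℂ) * ((1 / Real.sqrt d : ℝ) : ℂ)) = d := by
    rw [← Complex.ofReal_mul, div_mul_div_comm, Real.mul_self_sqrt (Nat.cast_nonneg d)]
    rcases Nat.eq_zero_or_pos d with rfl | h
    · simp
    · have : (d : ℂ) ≠ 0 := by exact_mod_cast h.ne'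
      push_cast
      field_simp
  rw [hTh, hL]
  ext u
  simp only [map_smulₛₗ, map_sum, ContinuousLinearMap.comp_apply,
    _root_.sum_apply, _root_.smul_apply, Finset.smul_sum, smul_smul, AATensor.block]
  rw [Finset.sum_comm]
  refine Finset.sum_congr rfl fun q _ => Finset.sum_congr rfl fun q' _ => ?_
  congr 1
  simp only [RCLike.star_def, RingHom.id_apply, map_mul, Complex.conj_ofReal]
  linear_combination ((U : Matrix (Fin d) (Fin d) ℂ) q.1 q.2 *
    (starRingEnd ℂ) ((U : Matrix (Fin d) (Fin d) ℂ) q'.1 q'.2)) * hd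

theorem theta_sub_integral_eq (Y : AATensor d R →L[ℂ] AATensor d R)
    (U : Matrix.unitaryGroup (Fin d) ℂ) :
    Theta Y U - ∫ V, Theta Y V ∂haarUnitary d
      = ∑ q, ∑ q', thetaCoeff U q q' • AATensor.block Y q q' := by
  have hc := @continuous_unitary_entry d
  have hint : ∀ q q' : Fin d × Fin d, Integrable (fun V : Matrix.unitaryGroup (Fin d) ℂ =>
      (d * ((V : Matrix (Fin d) (Fin d) ℂ) q.1 q.2 *
      star ((V : Matrix (Fin d) (Fin d) ℂ) q'.1 q'.2))) • AATensor.block Y q q') (haarUnitary d) :=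
    fun q q' => Continuous.integrable_haarUnitary
      ((continuous_const.mul ((hc _ _).mul (hc _ _).star)).smul continuous_const)
  have h2 : ∀ x y : Fin d × Fin d, ∫ U : Matrix.unitaryGroup (Fin d) ℂ,
      (d * ((U : Matrix (Fin d) (Fin d) ℂ) x.1 x.2 *
        star ((U : Matrix (Fin d) (Fin d) ℂ) y.1 y.2)))
        ∂haarUnitary d = if x = y then 1 else 0 := fun x y => by
    have := haarMoment₂_eq x.2 y.2 x.1 y.1
    rw [haarMoment₂] at this
    rw [integral_const_mul, this]
    have hd : (d : ℂ) ≠ 0 := by exact_mod_cast (x.1.pos).ne'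
    simp only [Prod.ext_iff, mul_ite, mul_zero]
    field_simp
  simp only [theta_eq_sum_block]
  rw [integral_finsetSum _ (fun x _ => integrable_finsetSum _ fun y _ => hint x y)]
  simp_rw [integral_finsetSum _ (fun y _ => hint _ y), integral_smul_const, h2]
  simp only [thetaCoeff, sub_smul, Finset.sum_sub_distrib]

theorem decouplingDeviation_eq (Y : AATensor d R →L[ℂ] AATensor d R)
    (U : Matrix.unitaryGroup (Fin d) ℂ) :
    decouplingDeviation Y U
      = schattenNorm 1 (∑ q, ∑ q', thetaCoeff U q q' • AATensor.block Y q q') := by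
  rw [decouplingDeviation, theta_sub_integral_eq]

theorem continuous_thetaCoeff (q q' : Fin d × Fin d) :
    Continuous fun U : Matrix.unitaryGroup (Fin d) ℂ => thetaCoeff U q q' :=
  (continuous_const.mul ((continuous_unitary_entry _ _).mul
    (continuous_unitary_entry _ _).star)).sub continuous_const

theorem lowerSemicontinuous_decouplingDeviation (Y : AATensor d R →L[ℂ] AATensor d R) :
    LowerSemicontinuous (decouplingDeviation Y) := by
  rw [funext (decouplingDeviation_eq Y)]
  refine lowerSemicontinuous_schattenNorm_one.comp ?_
  exact continuous_finsetSum _ fun q _ => continuous_finsetSum _ fun q' _ =>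
    (continuous_thetaCoeff q q').smul continuous_const

theorem measurable_decouplingDeviation (Y : AATensor d R →L[ℂ] AATensor d R) :
    Measurable (decouplingDeviation Y) :=
  (lowerSemicontinuous_decouplingDeviation Y).measurable

/-- Lower semicontinuity of the decoupling error in the operator norm, by Fatou's lemma. -/
theorem decouplingError_le_of_tendsto {Y : AATensor d R →L[ℂ] AATensor d R}
    {Y' : ℕ → AATensor d R →L[ℂ] AATensor d R} (hY : Filter.Tendsto Y' Filter.atTop (nhds Y))
    {M : ℝ≥0∞} (hM : ∀ n, decouplingError (Y' n) ≤ M) : decouplingError Y ≤ M := by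
  have h : ∀ U, decouplingDeviation Y U
      ≤ Filter.liminf (fun n => decouplingDeviation (Y' n) U) Filter.atTop := by
    intro U
    simp only [decouplingDeviation_eq]
    have hc : Continuous fun Y : AATensor d R →L[ℂ] AATensor d R =>
        ∑ q, ∑ q', thetaCoeff U q q' • AATensor.block Y q q' :=
      continuous_finsetSum _ fun q _ => continuous_finsetSum _ fun q' _ =>
        by have := AATensor.continuous_block (R := R) q q'; fun_prop
    have hlsc := (lowerSemicontinuous_schattenNorm_one.comp hc) Y
    refine le_of_forall_lt fun c hc' => ?_
    obtain ⟨c', hcc', hc''⟩ := exists_between hc'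
    refine lt_of_lt_of_le hcc' (Filter.le_liminf_of_le ?_ ?_)
    · exact Filter.isCoboundedUnder_ge_of_le _ fun _ => le_top
    · exact (hY.eventually (hlsc c' hc'')).mono fun n hn => hn.le
  calc decouplingError Y ≤ ∫⁻ U, Filter.liminf (fun n => decouplingDeviation (Y' n) U) Filter.atTop
        ∂haarUnitary d := lintegral_mono h
    _ ≤ Filter.liminf (fun n => ∫⁻ U, decouplingDeviation (Y' n) U ∂haarUnitary d) Filter.atTop :=
        lintegral_liminf_le fun n => measurable_decouplingDeviation _
    _ ≤ M := Filter.liminf_le_of_le (by isBoundedDefault) fun c hc => by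
        obtain ⟨n, hn⟩ := hc.exists
        exact hn.trans (hM n)

/-- For `Z = ∑ₖ rₖ |xₖ⟩⟨yₖ|`, `A = a` and `B = b†`, the functional `G ↦ Tr (G X)` on `B(R)`, where
`X = Θ(Y)(U) - E_V Θ(Y)(V)` and `Y = (1 ⊗ a) Z (1 ⊗ b)`. -/
noncomputable def deviationFunctional {n : ℕ} (x y : Fin n → AATensor d R) (A B : R →L[ℂ] R)
    (r : Fin n → ℂ) (U : Matrix.unitaryGroup (Fin d) ℂ) : StrongDual ℂ (R →L[ℂ] R) :=
  ∑ k, r k • ∑ q, ∑ q', thetaCoeff U q q' • rankOneFunctional (A (x k q)) (B (y k q'))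

omit [CompleteSpace R] in
theorem continuous_deviationFunctional {n : ℕ} (x y : Fin n → AATensor d R) (A B : R →L[ℂ] R)
    (r : Fin n → ℂ) : Continuous (deviationFunctional x y A B r) :=
  continuous_finsetSum _ fun k _ => by
    have h : ∀ q q', Continuous fun U : Matrix.unitaryGroup (Fin d) ℂ =>
        thetaCoeff U q q' • rankOneFunctional (A (x k q)) (B (y k q')) :=
      fun q q' => (continuous_thetaCoeff q q').smul continuous_const
    fun_prop

/-- The functional `G ↦ Tr (G X)` controls the trace norm of the deviation `X`. -/
theorem decouplingDeviation_le_enorm_deviationFunctional {n : ℕ} (x y : Fin n → AATensor d R)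
    (a b : R →L[ℂ] R) (r : Fin n → ℂ) (U : Matrix.unitaryGroup (Fin d) ℂ) :
    decouplingDeviation
        (onR d a ∘L (∑ k, r k • InnerProductSpace.rankOne ℂ (x k) (y k)) ∘L onR d b) U
      ≤ ‖deviationFunctional x y a (ContinuousLinearMap.adjoint b) r U‖ₑ := by
  rw [decouplingDeviation_eq]
  refine schattenNorm_one_le_of_functional fun u v => ?_
  simp only [deviationFunctional, AATensor.block_onR, AATensor.block_sum_smul,
    AATensor.block_rankOne, _root_.sum_apply, _root_.smul_apply, rankOneFunctional_apply,
    ContinuousLinearMap.comp_apply, InnerProductSpace.rankOne_apply, inner_sum, inner_smul_right,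
    map_sum, map_smul, ContinuousLinearMap.adjoint_inner_left, smul_eq_mul, Finset.mul_sum]
  rw [Finset.sum_comm]
  refine Finset.sum_congr rfl fun q _ => ?_
  rw [Finset.sum_comm]
  refine Finset.sum_congr rfl fun q' _ => Finset.sum_congr rfl fun k _ => ?_
  ring

/-- Integrating a bound on the functional bounds the decoupling error. -/
theorem decouplingError_le_of_integral_norm_le {n : ℕ} (x y : Fin n → AATensor d R)
    (a b : R →L[ℂ] R) (r : Fin n → ℂ) {M : ℝ}
    (h : ∫ U, ‖deviationFunctional x y a (ContinuousLinearMap.adjoint b) r U‖ ∂haarUnitary d ≤ M) :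
    decouplingError
        (onR d a ∘L (∑ k, r k • InnerProductSpace.rankOne ℂ (x k) (y k)) ∘L onR d b)
      ≤ ENNReal.ofReal M := by
  refine (lintegral_mono fun U =>
    decouplingDeviation_le_enorm_deviationFunctional x y a b r U).trans ?_
  rw [← ofReal_integral_norm_eq_lintegral_enorm
    (continuous_deviationFunctional _ _ _ _ _).integrable_haarUnitary]
  exact ENNReal.ofReal_le_ofReal h

omit [CompleteSpace R] in
theorem rankOneFunctional_sum_sum {ι κ : Type*} (S : Finset ι) (T : Finset κ) (x : ι → R)
    (y : κ → R) (c : ι → ℂ) (c' : κ → ℂ) :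
    rankOneFunctional (∑ i ∈ S, c i • x i) (∑ j ∈ T, star (c' j) • y j)
      = ∑ i ∈ S, ∑ j ∈ T, (c i * c' j) • rankOneFunctional (x i) (y j) := by
  ext G
  simp only [rankOneFunctional_apply, map_sum, map_smul, sum_inner, inner_sum, inner_smul_left,
    inner_smul_right, _root_.sum_apply, _root_.smul_apply, smul_eq_mul, Finset.mul_sum]
  refine Finset.sum_congr rfl fun i _ => Finset.sum_congr rfl fun j _ => ?_
  simp only [RCLike.star_def, RingHomCompTriple.comp_apply, RingHom.id_apply]
  ring

omit [CompleteSpace R] in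
theorem integral_norm_sq_sum_smul_entry (x : AATensor d R) :
    ∫ U : Matrix.unitaryGroup (Fin d) ℂ,
      d * ‖∑ q, (U : Matrix (Fin d) (Fin d) ℂ) q.1 q.2 • x q‖ ^ 2 ∂haarUnitary d = ‖x‖ ^ 2 := by
  have hc := @continuous_unitary_entry d
  have h1 : ∀ U : Matrix.unitaryGroup (Fin d) ℂ,
      ((d * ‖∑ q, (U : Matrix (Fin d) (Fin d) ℂ) q.1 q.2 • x q‖ ^ 2 : ℝ) : ℂ)
      = ∑ q, ∑ q', (d * ⟪x q', x q⟫_ℂ) * ((U : Matrix (Fin d) (Fin d) ℂ) q.1 q.2 *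
        star ((U : Matrix (Fin d) (Fin d) ℂ) q'.1 q'.2)) := by
    intro U
    have h := inner_self_eq_norm_sq_to_K (𝕜 := ℂ)
      (∑ q, (U : Matrix (Fin d) (Fin d) ℂ) q.1 q.2 • x q)
    rw [Complex.ofReal_mul, Complex.ofReal_pow, Complex.ofReal_natCast]
    refine (congrArg (fun z : ℂ => (d : ℂ) * z) h.symm).trans ?_
    simp only [sum_inner, inner_sum, inner_smul_left, inner_smul_right, Finset.mul_sum]
    refine Finset.sum_congr rfl fun q _ => Finset.sum_congr rfl fun q' _ => ?_
    simp only [RCLike.star_def]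
    ring
  have hint : ∀ q q' : Fin d × Fin d, Integrable (fun U : Matrix.unitaryGroup (Fin d) ℂ =>
      (d * ⟪x q', x q⟫_ℂ) * ((U : Matrix (Fin d) (Fin d) ℂ) q.1 q.2 *
        star ((U : Matrix (Fin d) (Fin d) ℂ) q'.1 q'.2))) (haarUnitary d) :=
    fun q q' => Continuous.integrable_haarUnitary
      (continuous_const.mul ((hc _ _).mul (hc _ _).star))
  have h2 : ∀ x y : Fin d × Fin d, ∫ U : Matrix.unitaryGroup (Fin d) ℂ,
      (U : Matrix (Fin d) (Fin d) ℂ) x.1 x.2 * star ((U : Matrix (Fin d) (Fin d) ℂ) y.1 y.2)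
        ∂haarUnitary d = if x = y then (1 / d : ℂ) else 0 := fun x y => by
    have := haarMoment₂_eq x.2 y.2 x.1 y.1
    rw [haarMoment₂] at this
    simp only [this, Prod.ext_iff]
  have h3 : ((∫ U : Matrix.unitaryGroup (Fin d) ℂ,
      d * ‖∑ q, (U : Matrix (Fin d) (Fin d) ℂ) q.1 q.2 • x q‖ ^ 2 ∂haarUnitary d : ℝ) : ℂ)
      = ((‖x‖ ^ 2 : ℝ) : ℂ) := by
    rw [← integral_complex_ofReal]
    simp only [h1]
    rw [integral_finsetSum _ (fun x _ => integrable_finsetSum _ fun y _ => hint x y)]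
    simp_rw [integral_finsetSum _ (fun y _ => hint _ y), integral_const_mul, h2]
    simp only [mul_ite, mul_zero, Finset.sum_ite_eq, Finset.mem_univ, if_true,
      AATensor.norm_sq_eq, Complex.ofReal_sum]
    refine Finset.sum_congr rfl fun q _ => ?_
    have hd : (d : ℂ) ≠ 0 := by exact_mod_cast (q.1.pos).ne'
    rw [inner_self_eq_norm_sq_to_K, Complex.ofReal_pow]
    field_simp
    rfl
  exact_mod_cast h3

/-- Endpoint `α = 1`. On a term `|x⟩⟨y|` of rank one, `Θ(|x⟩⟨y|)(U) = |ξ(U)⟩⟨η(U)|` with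
`E ‖ξ(U)‖² = ‖x‖²` and `E ‖η(U)‖² = ‖y‖²`. -/
theorem integral_norm_deviationFunctional_le {n : ℕ} {x y : Fin n → AATensor d R}
    (hx : ∀ k, ‖x k‖ = 1) (hy : ∀ k, ‖y k‖ = 1) (A B : R →L[ℂ] R) (r : Fin n → ℂ) :
    ∫ U, ‖deviationFunctional x y A B r U‖ ∂haarUnitary d ≤ 2 * ‖A‖ * ‖B‖ * ∑ k, ‖r k‖ := by
  have hc := @continuous_unitary_entry d
  set ξ : AATensor d R → Matrix.unitaryGroup (Fin d) ℂ → ℝ := fun z U =>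
    d * ‖∑ q, (U : Matrix (Fin d) (Fin d) ℂ) q.1 q.2 • z q‖ ^ 2 with hξ
  have hξi : ∀ z, Integrable (ξ z) (haarUnitary d) := fun z =>
    Continuous.integrable_haarUnitary (continuous_const.mul ((continuous_finsetSum _ fun q _ =>
      (hc _ _).smul continuous_const).norm.pow 2))
  have key : ∀ k U, ‖∑ q, ∑ q', thetaCoeff U q q' • rankOneFunctional (A (x k q)) (B (y k q'))‖
      ≤ ‖A‖ * ‖B‖ * ((ξ (x k) U + ξ (y k) U) / 2 + 1) := by
    intro k U
    have h1 : ∑ q, ∑ q', thetaCoeff U q q' • rankOneFunctional (A (x k q)) (B (y k q'))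
        = (d : ℂ) • rankOneFunctional
            (A (∑ q, (U : Matrix (Fin d) (Fin d) ℂ) q.1 q.2 • x k q))
            (B (∑ q, (U : Matrix (Fin d) (Fin d) ℂ) q.1 q.2 • y k q))
          - ∑ q, rankOneFunctional (A (x k q)) (B (y k q)) := by
      have h2 := rankOneFunctional_sum_sum Finset.univ Finset.univ (fun q => A (x k q))
        (fun q => B (y k q)) (fun q => (U : Matrix (Fin d) (Fin d) ℂ) q.1 q.2)
        (fun q => star ((U : Matrix (Fin d) (Fin d) ℂ) q.1 q.2))
      simp only [star_star] at h2
      simp only [map_sum, map_smul] at h2 ⊢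
      rw [h2, Finset.smul_sum]
      have hs : ∀ (a b : ℂ) (φ : StrongDual ℂ (R →L[ℂ] R)), (a - b) • φ = a • φ - b • φ :=
        fun a b φ => sub_smul a b φ
      have h0 : ∀ φ : StrongDual ℂ (R →L[ℂ] R), (0 : ℂ) • φ = 0 := fun φ => zero_smul ℂ φ
      simp only [thetaCoeff, hs, Finset.sum_sub_distrib, Finset.smul_sum, smul_smul]
      simp [h0]
    rw [h1]
    have hAB : ∀ u v : R,
        ‖rankOneFunctional (A u) (B v)‖ ≤ ‖A‖ * ‖B‖ * ((‖u‖ ^ 2 + ‖v‖ ^ 2) / 2) := by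
      intro u v
      refine (norm_rankOneFunctional_le _ _).trans ?_
      calc ‖A u‖ * ‖B v‖ ≤ (‖A‖ * ‖u‖) * (‖B‖ * ‖v‖) := by
            gcongr
            · exact A.le_opNorm u
            · exact B.le_opNorm v
        _ = ‖A‖ * ‖B‖ * (‖u‖ * ‖v‖) := by ring
        _ ≤ _ := by
            gcongr
            nlinarith [sq_nonneg (‖u‖ - ‖v‖)]
    refine (norm_sub_le _ _).trans ?_
    rw [mul_add, mul_one]
    refine add_le_add ?_ ?_
    · rw [norm_smul, Complex.norm_natCast]
      calc (d : ℝ) * _ ≤ d * _ := mul_le_mul_of_nonneg_left (hAB _ _) (Nat.cast_nonneg d)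
        _ = _ := by simp only [hξ]; ring
    · refine (norm_sum_le _ _).trans ((Finset.sum_le_sum fun q _ => hAB _ _).trans (le_of_eq ?_))
      rw [← Finset.mul_sum, ← Finset.sum_div, Finset.sum_add_distrib, ← AATensor.norm_sq_eq,
        ← AATensor.norm_sq_eq, hx, hy]
      norm_num
  have hint : ∀ k, Integrable (fun U => ‖r k‖ * (‖A‖ * ‖B‖ * ((ξ (x k) U + ξ (y k) U) / 2 + 1)))
      (haarUnitary d) := fun k =>
    ((((((hξi _).add (hξi _)).div_const 2).add (integrable_const 1)).const_mul _).const_mul _)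
  have hξ2 : ∀ k, Integrable (fun U => ξ (x k) U + ξ (y k) U) (haarUnitary d) := fun k =>
    (hξi _).add (hξi _)
  calc ∫ U, ‖deviationFunctional x y A B r U‖ ∂haarUnitary d
      ≤ ∫ U, ∑ k, ‖r k‖ * (‖A‖ * ‖B‖ * ((ξ (x k) U + ξ (y k) U) / 2 + 1)) ∂haarUnitary d := by
        refine integral_mono
          (continuous_deviationFunctional _ _ _ _ _).integrable_haarUnitary.norm
          (integrable_finsetSum _ fun k _ => hint k) fun U => ?_
        refine (norm_sum_le _ _).trans (Finset.sum_le_sum fun k _ => ?_)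
        rw [norm_smul]
        exact mul_le_mul_of_nonneg_left (key k U) (norm_nonneg _)
    _ = ∑ k, ‖r k‖ * (‖A‖ * ‖B‖ * 2) := by
        rw [integral_finsetSum _ fun k _ => hint k]
        refine Finset.sum_congr rfl fun k _ => ?_
        rw [integral_const_mul, integral_const_mul, integral_add
          ((hξ2 k).div_const 2) (integrable_const 1), integral_div,
          integral_add (hξi _) (hξi _), hξ]
        simp only [integral_norm_sq_sum_smul_entry, hx, hy, integral_const, probReal_univ, one_smul]
        norm_num
    _ = 2 * ‖A‖ * ‖B‖ * ∑ k, ‖r k‖ := by rw [← Finset.sum_mul]; ring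

end Blocks

/-! ### Matrix elements of the deviation -/

section Hoelder

variable {d : ℕ} {R : Type*} [NormedAddCommGroup R] [InnerProductSpace ℂ R]

/-- Cauchy-Schwarz inequality for a kernel with bounded row and column sums. -/
theorem sq_sum_weighted_le {ι κ : Type*} [Fintype ι] [Fintype κ] (a : ι → ℝ) (b : κ → ℝ)
    {p : ι → κ → ℝ} {c : ℝ} (hp : ∀ i j, 0 ≤ p i j) (hrow : ∀ i, ∑ j, p i j ≤ c)
    (hcol : ∀ j, ∑ i, p i j ≤ c) :
    (∑ i, ∑ j, a i * b j * p i j) ^ 2 ≤ (c * ∑ i, a i ^ 2) * (c * ∑ j, b j ^ 2) := by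
  have h := Finset.sum_mul_sq_le_sq_mul_sq (Finset.univ : Finset (ι × κ))
    (fun z => a z.1 * Real.sqrt (p z.1 z.2)) (fun z => b z.2 * Real.sqrt (p z.1 z.2))
  have e1 : ∀ z : ι × κ, a z.1 * Real.sqrt (p z.1 z.2) * (b z.2 * Real.sqrt (p z.1 z.2))
      = a z.1 * b z.2 * p z.1 z.2 := fun z => by
    have := Real.mul_self_sqrt (hp z.1 z.2)
    linear_combination (a z.1 * b z.2) * this
  simp only [e1, mul_pow, Real.sq_sqrt (hp _ _), Fintype.sum_prod_type] at h
  refine h.trans (mul_le_mul ?_ ?_ ?_ ?_)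
  · simp only [← Finset.mul_sum]
    rw [mul_comm c, Finset.sum_mul]
    gcongr with i
    exact hrow i
  · rw [Finset.sum_comm]
    simp only [← Finset.mul_sum]
    rw [mul_comm c, Finset.sum_mul]
    gcongr with i
    exact hcol i
  · exact Finset.sum_nonneg fun i _ => Finset.sum_nonneg fun j _ => by
      have := hp i j; positivity
  · rcases isEmpty_or_nonempty ι with h | ⟨⟨i⟩⟩
    · simp
    · have : 0 ≤ c := (Finset.sum_nonneg fun j _ => hp i j).trans (hrow i)
      positivity

/-- The matrix element `⟨f, (Θ(|x⟩⟨y|)(U) - E_V Θ(|x⟩⟨y|)(V)) g⟩`. -/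
noncomputable def deviationEntry (x y : AATensor d R) (f g : R)
    (U : Matrix.unitaryGroup (Fin d) ℂ) : ℂ :=
  ∑ q, ∑ q', (⟪f, x q⟫_ℂ * ⟪y q', g⟫_ℂ) * thetaCoeff U q q'

theorem continuous_deviationEntry (x y : AATensor d R) (f g : R) :
    Continuous (deviationEntry x y f g) :=
  continuous_finsetSum _ fun q _ => continuous_finsetSum _ fun q' _ =>
    continuous_const.mul (continuous_thetaCoeff q q')

variable [CompleteSpace R]

theorem deviationFunctional_eq_sum {n m m' : ℕ} (x y : Fin n → AATensor d R)
    (e f : Fin m → R) (g h : Fin m' → R) (s : Fin m → ℂ) (t : Fin m' → ℂ) (r : Fin n → ℂ)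
    (U : Matrix.unitaryGroup (Fin d) ℂ) :
    deviationFunctional x y (∑ i, s i • InnerProductSpace.rankOne ℂ (e i) (f i))
      (ContinuousLinearMap.adjoint (∑ j, t j • InnerProductSpace.rankOne ℂ (g j) (h j))) r U
    = ∑ i, ∑ j, ∑ k, (s i * t j * r k) •
        (deviationEntry (x k) (y k) (f i) (g j) U • rankOneFunctional (e i) (h j)) := by
  have h1 : ∀ {κ : Type} [Fintype κ] (F : κ → Fin m → Fin m' → ℂ),
      ∑ q, ∑ i, ∑ j, F q i j = ∑ i, ∑ j, ∑ q, F q i j := fun F => by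
    rw [Finset.sum_comm]
    exact Finset.sum_congr rfl fun i _ => Finset.sum_comm
  have h2 : ∀ (F : Fin d × Fin d → Fin m → Fin m' → ℂ),
      ∑ q, ∑ i, ∑ j, F q i j = ∑ i, ∑ j, ∑ q, F q i j := h1
  ext G
  have h3 : ∀ u v : R, rankOneFunctional
      ((∑ i, s i • InnerProductSpace.rankOne ℂ (e i) (f i)) u)
      (ContinuousLinearMap.adjoint (∑ j, t j • InnerProductSpace.rankOne ℂ (g j) (h j)) v) G
      = ∑ i, ∑ j, s i * t j * (⟪f i, u⟫_ℂ * ⟪v, g j⟫_ℂ) * ⟪h j, G (e i)⟫_ℂ := by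
    intro u v
    rw [rankOneFunctional_apply, ContinuousLinearMap.adjoint_inner_left]
    simp only [_root_.sum_apply, _root_.smul_apply, InnerProductSpace.rankOne_apply, map_sum,
      map_smul, inner_sum, inner_smul_right, Finset.mul_sum]
    exact Finset.sum_congr rfl fun i _ => Finset.sum_congr rfl fun j _ => by ring
  generalize (∑ i, s i • InnerProductSpace.rankOne ℂ (e i) (f i)) = A at h3 ⊢
  generalize ContinuousLinearMap.adjoint
    (∑ j, t j • InnerProductSpace.rankOne ℂ (g j) (h j)) = B at h3 ⊢
  simp only [deviationFunctional, _root_.sum_apply, _root_.smul_apply, h3, smul_eq_mul,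
    Finset.mul_sum, h2, rankOneFunctional_apply, deviationEntry, Finset.sum_mul]
  rw [h1]
  refine Finset.sum_congr rfl fun i _ => Finset.sum_congr rfl fun j _ =>
    Finset.sum_congr rfl fun k _ => Finset.sum_congr rfl fun q _ =>
    Finset.sum_congr rfl fun q' _ => ?_
  ring

omit [CompleteSpace R] in
/-- The Hilbert-Schmidt norm of `Z = ∑ₖ rₖ |xₖ⟩⟨yₖ|` bounds its matrix elements. -/
theorem sum_norm_sq_entry_le {n m m' : ℕ} {x y : Fin n → AATensor d R} {f : Fin m → R}
    {g : Fin m' → R} (hx : Orthonormal ℂ x) (hy : ∀ k, ‖y k‖ = 1) (hf : Orthonormal ℂ f)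
    (hg : Orthonormal ℂ g) (r : Fin n → ℂ) :
    ∑ i, ∑ j, ∑ q, ∑ q', ‖∑ k, r k * (⟪f i, x k q⟫_ℂ * ⟪y k q', g j⟫_ℂ)‖ ^ 2
      ≤ ∑ k, ‖r k‖ ^ 2 := by
  have h1 : ∀ j q', ∑ i, ∑ q, ‖∑ k, r k * (⟪f i, x k q⟫_ℂ * ⟪y k q', g j⟫_ℂ)‖ ^ 2
      ≤ ∑ k, ‖r k‖ ^ 2 * ‖⟪g j, y k q'⟫_ℂ‖ ^ 2 := by
    intro j q'
    set v : AATensor d R := ∑ k, (r k * ⟪y k q', g j⟫_ℂ) • x k with hv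
    have h2 : ∀ i q, ∑ k, r k * (⟪f i, x k q⟫_ℂ * ⟪y k q', g j⟫_ℂ) = ⟪f i, v q⟫_ℂ := by
      intro i q
      simp only [hv, WithLp.ofLp_sum, WithLp.ofLp_smul, Finset.sum_apply, Pi.smul_apply, inner_sum,
        inner_smul_right]
      exact Finset.sum_congr rfl fun k _ => by ring
    simp only [h2]
    rw [Finset.sum_comm]
    calc ∑ q, ∑ i, ‖⟪f i, v q⟫_ℂ‖ ^ 2 ≤ ∑ q, ‖v q‖ ^ 2 :=
          Finset.sum_le_sum fun q _ => hf.sum_inner_products_le (v q)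
      _ = ‖v‖ ^ 2 := (AATensor.norm_sq_eq v).symm
      _ = _ := by
          rw [hv, norm_sq_sum_smul_of_orthonormal hx]
          simp only [norm_mul, mul_pow, norm_inner_symm]
  calc ∑ i, ∑ j, ∑ q, ∑ q', ‖∑ k, r k * (⟪f i, x k q⟫_ℂ * ⟪y k q', g j⟫_ℂ)‖ ^ 2
      = ∑ j, ∑ q', ∑ i, ∑ q, ‖∑ k, r k * (⟪f i, x k q⟫_ℂ * ⟪y k q', g j⟫_ℂ)‖ ^ 2 := by
        rw [Finset.sum_comm]
        refine Finset.sum_congr rfl fun j _ => ?_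
        rw [Finset.sum_comm (s := (Finset.univ : Finset (Fin d × Fin d)))]
        exact Finset.sum_congr rfl fun i _ => Finset.sum_comm
    _ ≤ ∑ j, ∑ q', ∑ k, ‖r k‖ ^ 2 * ‖⟪g j, y k q'⟫_ℂ‖ ^ 2 :=
        Finset.sum_le_sum fun j _ => Finset.sum_le_sum fun q' _ => h1 j q'
    _ = ∑ k, ‖r k‖ ^ 2 * ∑ q', ∑ j, ‖⟪g j, y k q'⟫_ℂ‖ ^ 2 := by
        rw [Finset.sum_comm]
        simp only [Finset.mul_sum]
        rw [Finset.sum_comm (s := (Finset.univ : Finset (Fin n)))]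
        refine Finset.sum_congr rfl fun q' _ => ?_
        rw [Finset.sum_comm]
    _ ≤ ∑ k, ‖r k‖ ^ 2 * 1 := by
        gcongr with k
        calc ∑ q', ∑ j, ‖⟪g j, y k q'⟫_ℂ‖ ^ 2 ≤ ∑ q', ‖y k q'‖ ^ 2 :=
              Finset.sum_le_sum fun q' _ => hg.sum_inner_products_le (y k q')
          _ = 1 := by rw [← AATensor.norm_sq_eq, hy]; norm_num
    _ = _ := by simp

end Hoelder

/-! ### The endpoint `α = 2` -/

section Interpolation

variable {d : ℕ} {R : Type*} [NormedAddCommGroup R] [InnerProductSpace ℂ R] [CompleteSpace R]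

theorem integral_sqrt_haarUnitary_le {F : Matrix.unitaryGroup (Fin d) ℂ → ℝ} (hF : Continuous F)
    (hF0 : ∀ U, 0 ≤ F U) :
    ∫ U, Real.sqrt (F U) ∂haarUnitary d ≤ Real.sqrt (∫ U, F U ∂haarUnitary d) := by
  refine Real.le_sqrt_of_sq_le ?_
  set m := ∫ U, Real.sqrt (F U) ∂haarUnitary d with hm
  have i1 := hF.integrable_haarUnitary
  have i2 : Integrable (fun U => 2 * m * Real.sqrt (F U)) (haarUnitary d) :=
    (hF.sqrt.integrable_haarUnitary).const_mul _
  have i3 : Integrable (fun U => F U - 2 * m * Real.sqrt (F U)) (haarUnitary d) := i1.sub i2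
  have h : 0 ≤ ∫ U, (F U - 2 * m * Real.sqrt (F U)) + m ^ 2 ∂haarUnitary d := by
    refine integral_nonneg fun U => ?_
    have := Real.mul_self_sqrt (hF0 U)
    have : F U - 2 * m * Real.sqrt (F U) + m ^ 2 = (Real.sqrt (F U) - m) ^ 2 := by
      linear_combination -this
    simp only [this]
    positivity
  rw [integral_add i3 (integrable_const _), integral_sub i1 i2, integral_const_mul, ← hm] at h
  simp only [integral_const, probReal_univ, one_smul] at h
  nlinarith

/-- Pointwise Hölder inequality `‖a X b‖₁ ≤ ‖a‖₄ ‖X‖₂ ‖b‖₄`. -/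
theorem norm_deviationFunctional_le {n m m' : ℕ} (x y : Fin n → AATensor d R)
    {e f : Fin m → R} {g h : Fin m' → R} (he : Orthonormal ℂ e) (hh : Orthonormal ℂ h)
    (s : Fin m → ℂ) (t : Fin m' → ℂ) (r : Fin n → ℂ) (U : Matrix.unitaryGroup (Fin d) ℂ) :
    ‖deviationFunctional x y (∑ i, s i • InnerProductSpace.rankOne ℂ (e i) (f i))
      (ContinuousLinearMap.adjoint (∑ j, t j • InnerProductSpace.rankOne ℂ (g j) (h j))) r U‖
      ≤ Real.sqrt (Real.sqrt ((∑ i, ‖s i‖ ^ 4) * ∑ j, ‖t j‖ ^ 4)) *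
        Real.sqrt (∑ i, ∑ j, ‖∑ k, r k * deviationEntry (x k) (y k) (f i) (g j) U‖ ^ 2) := by
  rw [deviationFunctional_eq_sum]
  refine ContinuousLinearMap.opNorm_le_bound _ (by positivity) fun G => ?_
  set M : Fin m → Fin m' → ℂ := fun i j => ∑ k, r k * deviationEntry (x k) (y k) (f i) (g j) U
  have h1 : (∑ i, ∑ j, ∑ k, (s i * t j * r k) •
        (deviationEntry (x k) (y k) (f i) (g j) U • rankOneFunctional (e i) (h j))) G
      = ∑ i, ∑ j, M i j * (s i * t j * ⟪h j, G (e i)⟫_ℂ) := by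
    simp only [_root_.sum_apply, _root_.smul_apply, smul_eq_mul, rankOneFunctional_apply, M,
      Finset.sum_mul]
    exact Finset.sum_congr rfl fun i _ => Finset.sum_congr rfl fun j _ =>
      Finset.sum_congr rfl fun k _ => by ring
  set p : Fin m → Fin m' → ℝ := fun i j => ‖⟪h j, G (e i)⟫_ℂ‖ ^ 2 with hp
  set P := ∑ i, ∑ j, ‖s i‖ ^ 2 * ‖t j‖ ^ 2 * p i j with hP
  have h2 : ‖∑ i, ∑ j, M i j * (s i * t j * ⟪h j, G (e i)⟫_ℂ)‖
      ≤ Real.sqrt (∑ i, ∑ j, ‖M i j‖ ^ 2) * Real.sqrt P := by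
    have h3 := Real.sum_mul_le_sqrt_mul_sqrt (Finset.univ : Finset (Fin m × Fin m'))
      (fun z => ‖M z.1 z.2‖) (fun z => ‖s z.1 * t z.2 * ⟪h z.2, G (e z.1)⟫_ℂ‖)
    simp only [Fintype.sum_prod_type, norm_mul, mul_pow] at h3
    refine le_trans ?_ h3
    refine (norm_sum_le _ _).trans (Finset.sum_le_sum fun i _ => (norm_sum_le _ _).trans
      (Finset.sum_le_sum fun j _ => ?_))
    rw [norm_mul, norm_mul, norm_mul]
  have hrow : ∀ i, ∑ j, p i j ≤ ‖G‖ ^ 2 := fun i => by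
    refine (hh.sum_inner_products_le (G (e i))).trans ?_
    gcongr
    simpa [he.1 i] using G.le_opNorm (e i)
  have hcol : ∀ j, ∑ i, p i j ≤ ‖G‖ ^ 2 := fun j => by
    have h4 : ∀ i, p i j = ‖⟪e i, ContinuousLinearMap.adjoint G (h j)⟫_ℂ‖ ^ 2 := fun i => by
      rw [ContinuousLinearMap.adjoint_inner_right, norm_inner_symm]
    simp only [h4]
    refine (he.sum_inner_products_le (ContinuousLinearMap.adjoint G (h j))).trans ?_
    gcongr
    have := (ContinuousLinearMap.adjoint G).le_opNorm (h j)
    rwa [hh.1 j, mul_one, LinearIsometryEquiv.norm_map] at this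
  have h5 : P ≤ ‖G‖ ^ 2 * Real.sqrt ((∑ i, ‖s i‖ ^ 4) * ∑ j, ‖t j‖ ^ 4) := by
    refine le_of_sq_le_sq ?_ (by positivity)
    have h6 := sq_sum_weighted_le (fun i => ‖s i‖ ^ 2) (fun j => ‖t j‖ ^ 2)
      (fun i j => by positivity : ∀ i j, 0 ≤ p i j) hrow hcol
    simp only [← pow_mul] at h6
    rw [mul_pow, Real.sq_sqrt (by positivity)]
    calc P ^ 2 ≤ _ := h6
      _ = _ := by norm_num; ring
  rw [h1]
  refine h2.trans ?_
  have h7 : Real.sqrt P ≤ ‖G‖ * Real.sqrt (Real.sqrt ((∑ i, ‖s i‖ ^ 4) * ∑ j, ‖t j‖ ^ 4)) := by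
    refine (Real.sqrt_le_sqrt h5).trans (le_of_eq ?_)
    rw [Real.sqrt_mul (by positivity), Real.sqrt_sq (norm_nonneg G)]
  calc _ ≤ Real.sqrt (∑ i, ∑ j, ‖M i j‖ ^ 2) *
        (‖G‖ * Real.sqrt (Real.sqrt ((∑ i, ‖s i‖ ^ 4) * ∑ j, ‖t j‖ ^ 4))) := by gcongr
    _ = _ := by ring

/-- Endpoint `α = 2`: Hölder's inequality and the variance bound for the matrix elements. -/
theorem integral_norm_deviationFunctional_le_schatten_two {n m m' : ℕ} {x y : Fin n → AATensor d R}
    {e f : Fin m → R} {g h : Fin m' → R} (hx : Orthonormal ℂ x) (hy : ∀ k, ‖y k‖ = 1)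
    (he : Orthonormal ℂ e) (hf : Orthonormal ℂ f) (hg : Orthonormal ℂ g) (hh : Orthonormal ℂ h)
    (s : Fin m → ℂ) (t : Fin m' → ℂ) (r : Fin n → ℂ) :
    ∫ U, ‖deviationFunctional x y (∑ i, s i • InnerProductSpace.rankOne ℂ (e i) (f i))
      (ContinuousLinearMap.adjoint (∑ j, t j • InnerProductSpace.rankOne ℂ (g j) (h j))) r U‖
        ∂haarUnitary d
      ≤ Real.sqrt (Real.sqrt ((∑ i, ‖s i‖ ^ 4) * ∑ j, ‖t j‖ ^ 4)) *
        Real.sqrt (4 / 3 * ∑ k, ‖r k‖ ^ 2) := by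
  set F : Matrix.unitaryGroup (Fin d) ℂ → ℝ := fun U =>
    ∑ i, ∑ j, ‖∑ k, r k * deviationEntry (x k) (y k) (f i) (g j) U‖ ^ 2 with hF
  have hMc : ∀ i j, Continuous fun U =>
      ‖∑ k, r k * deviationEntry (x k) (y k) (f i) (g j) U‖ ^ 2 := fun i j =>
    (continuous_finsetSum _ fun k _ => continuous_const.mul
      (continuous_deviationEntry (x k) (y k) (f i) (g j))).norm.pow 2
  have hFc : Continuous F := continuous_finsetSum _ fun i _ => continuous_finsetSum _ fun j _ =>
    hMc i j
  have hF0 : ∀ U, 0 ≤ F U := fun U => by positivity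
  have hEF : ∫ U, F U ∂haarUnitary d ≤ 4 / 3 * ∑ k, ‖r k‖ ^ 2 := by
    rw [hF, integral_finsetSum _ fun i _ => integrable_finsetSum _ fun j _ =>
      (hMc i j).integrable_haarUnitary]
    simp_rw [integral_finsetSum _ fun j _ => (hMc _ j).integrable_haarUnitary]
    have h1 : ∀ i j, ∫ U, ‖∑ k, r k * deviationEntry (x k) (y k) (f i) (g j) U‖ ^ 2 ∂haarUnitary d
        ≤ 4 / 3 * ∑ q, ∑ q', ‖∑ k, r k * (⟪f i, x k q⟫_ℂ * ⟪y k q', g j⟫_ℂ)‖ ^ 2 := by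
      intro i j
      refine le_trans (le_of_eq ?_) (integral_norm_sq_thetaCoeff_le
        (fun q q' => ∑ k, r k * (⟪f i, x k q⟫_ℂ * ⟪y k q', g j⟫_ℂ)))
      congr 1; ext U
      congr 2
      simp only [deviationEntry, Finset.mul_sum, Finset.sum_mul]
      rw [Finset.sum_comm]
      refine Finset.sum_congr rfl fun q _ => ?_
      rw [Finset.sum_comm]
      exact Finset.sum_congr rfl fun q' _ => Finset.sum_congr rfl fun k _ => by ring
    calc _ ≤ ∑ i, ∑ j, 4 / 3 * ∑ q, ∑ q', ‖∑ k, r k * (⟪f i, x k q⟫_ℂ * ⟪y k q', g j⟫_ℂ)‖ ^ 2 :=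
          Finset.sum_le_sum fun i _ => Finset.sum_le_sum fun j _ => h1 i j
      _ ≤ _ := by
          simp only [← Finset.mul_sum]
          gcongr
          exact sum_norm_sq_entry_le hx hy hf hg r
  calc _ ≤ ∫ U, Real.sqrt (Real.sqrt ((∑ i, ‖s i‖ ^ 4) * ∑ j, ‖t j‖ ^ 4)) * Real.sqrt (F U)
        ∂haarUnitary d := by
        refine integral_mono (continuous_deviationFunctional _ _ _ _ _).integrable_haarUnitary.norm
          (hFc.sqrt.integrable_haarUnitary.const_mul _) fun U => ?_
        exact norm_deviationFunctional_le x y he hh s t r U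
    _ ≤ _ := by
        rw [integral_const_mul]
        gcongr
        exact (integral_sqrt_haarUnitary_le hFc hF0).trans (Real.sqrt_le_sqrt hEF)

/-- The three lines theorem for exponential sums. -/
theorem norm_expSum_le {E : Type*} [NormedAddCommGroup E] [NormedSpace ℂ E] {ι : Type*} [Fintype ι]
    (p q : ι → ℝ) (w : ι → E) {M₀ M₁ θ : ℝ} (hθ : θ ∈ Set.Icc 0 1)
    (h0 : ∀ z : ℂ, z.re = 0 → ‖∑ i, Complex.exp (p i + q i * z) • w i‖ ≤ M₀)
    (h1 : ∀ z : ℂ, z.re = 1 → ‖∑ i, Complex.exp (p i + q i * z) • w i‖ ≤ M₁) :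
    ‖∑ i, Complex.exp (p i + q i * θ) • w i‖ ≤ M₀ ^ (1 - θ) * M₁ ^ θ := by
  have h := Complex.HadamardThreeLines.norm_le_interp_of_mem_verticalClosedStrip₀₁'
    (fun z : ℂ => ∑ i, Complex.exp (p i + q i * z) • w i) (z := (θ : ℂ)) (a := M₀) (b := M₁)
    (by simpa [Complex.HadamardThreeLines.verticalClosedStrip] using hθ) ?_ ?_ h0 h1
  · simpa using h
  · refine Differentiable.diffContOnCl (Differentiable.fun_sum fun i _ => ?_)
    refine Differentiable.smul_const ?_ _
    fun_prop
  · refine ⟨∑ i, Real.exp (|p i| + |q i|) * ‖w i‖, ?_⟩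
    rintro _ ⟨z, hz, rfl⟩
    refine (norm_sum_le _ _).trans (Finset.sum_le_sum fun i _ => ?_)
    rw [norm_smul, Complex.norm_exp]
    gcongr
    have hz' : z.re ∈ Set.Icc (0 : ℝ) 1 := hz
    have h2 : ((p i : ℂ) + q i * z).re = p i + q i * z.re := by simp
    rw [h2]
    have h3 : q i * z.re ≤ |q i| := by
      calc q i * z.re ≤ |q i| * z.re := mul_le_mul_of_nonneg_right (le_abs_self _) hz'.1
        _ ≤ |q i| * 1 := mul_le_mul_of_nonneg_left hz'.2 (abs_nonneg _)
        _ = _ := mul_one _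
    linarith [le_abs_self (p i)]

end Interpolation

/-! ### Interpolation for operators of finite rank -/

section FiniteRank

variable {d : ℕ} {R : Type*} [NormedAddCommGroup R] [InnerProductSpace ℂ R] [CompleteSpace R]

/-- The three lines theorem for exponential sums in `L¹(U(d), V)`. -/
theorem integral_norm_expSum_le {V : Type*} [NormedAddCommGroup V] [NormedSpace ℂ V]
    {ι : Type*} [Fintype ι] (p q : ι → ℝ) {w : ι → Matrix.unitaryGroup (Fin d) ℂ → V}
    (hw : ∀ i, Continuous (w i)) {M₀ M₁ θ : ℝ} (hθ : θ ∈ Set.Icc 0 1)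
    (h0 : ∀ z : ℂ, z.re = 0 →
      ∫ U, ‖∑ i, Complex.exp (p i + q i * z) • w i U‖ ∂haarUnitary d ≤ M₀)
    (h1 : ∀ z : ℂ, z.re = 1 →
      ∫ U, ‖∑ i, Complex.exp (p i + q i * z) • w i U‖ ∂haarUnitary d ≤ M₁) :
    ∫ U, ‖∑ i, Complex.exp (p i + q i * θ) • w i U‖ ∂haarUnitary d ≤ M₀ ^ (1 - θ) * M₁ ^ θ := by
  have hM : SecondCountableTopology (Matrix (Fin d) (Fin d) ℂ) :=
    inferInstanceAs (SecondCountableTopology (Fin d → Fin d → ℂ))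
  have hG : SecondCountableTopology (Matrix.unitaryGroup (Fin d) ℂ) :=
    TopologicalSpace.Subtype.secondCountableTopology _
  have hnorm : ∀ c : ι → ℂ,
      ‖∑ i, c i • ContinuousMap.toLp (E := V) 1 (haarUnitary d) ℂ ⟨w i, hw i⟩‖
        = ∫ U, ‖∑ i, c i • w i U‖ ∂haarUnitary d := by
    intro c
    simp only [← map_smul, ← map_sum]
    rw [L1.norm_eq_integral_norm]
    refine integral_congr_ae ?_
    filter_upwards [ContinuousMap.coeFn_toLp (p := 1) (𝕜 := ℂ) (haarUnitary d)
      (∑ i, c i • (⟨w i, hw i⟩ : C(Matrix.unitaryGroup (Fin d) ℂ, V)))] with U hU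
    rw [hU]
    simp
  simp only [← hnorm] at h0 h1 ⊢
  exact norm_expSum_le p q _ hθ h0 h1

theorem norm_exp_ofReal_mul (a : ℝ) (z : ℂ) : ‖Complex.exp (a * z)‖ = Real.exp (a * z.re) := by
  rw [Complex.norm_exp]; simp

/-- The interpolated bound for operators of finite rank. With `θ = 2 (α - 1) / α`, the singular
values are deformed to `s ^ (z / θ)`, `r ^ (α (1 - z / 2))` and `t ^ (z / θ)`; the line `Re z = 0`
is the endpoint `α = 1` and the line `Re z = 1` is the endpoint `α = 2`. -/
theorem decouplingError_finiteRank_le {α : ℝ} (hα : 1 < α) (hα2 : α ≤ 2) {n m m' : ℕ}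
    {x y : Fin n → AATensor d R} {e f : Fin m → R} {g h : Fin m' → R} (hx : Orthonormal ℂ x)
    (hy : Orthonormal ℂ y) (he : Orthonormal ℂ e) (hf : Orthonormal ℂ f) (hg : Orthonormal ℂ g)
    (hh : Orthonormal ℂ h) {s : Fin m → ℝ} {t : Fin m' → ℝ} {r : Fin n → ℝ} (hs : ∀ i, 0 < s i)
    (ht : ∀ j, 0 < t j) (hr : ∀ k, 0 < r k) :
    decouplingError (onR d (∑ i, (s i : ℂ) • InnerProductSpace.rankOne ℂ (e i) (f i)) ∘L
        (∑ k, (r k : ℂ) • InnerProductSpace.rankOne ℂ (x k) (y k)) ∘L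
        onR d (∑ j, (t j : ℂ) • InnerProductSpace.rankOne ℂ (g j) (h j)))
      ≤ ENNReal.ofReal (2 * 3 ^ ((1 - α) / α) *
        ((∑ i, s i ^ (2 * (α / (α - 1)))) ^ (1 / (2 * (α / (α - 1)))) * (∑ k, r k ^ α) ^ (1 / α) *
          (∑ j, t j ^ (2 * (α / (α - 1)))) ^ (1 / (2 * (α / (α - 1)))))) := by
  have hα0 : 0 < α := by linarith
  have hα1 : 0 < α - 1 := by linarith
  set θ : ℝ := 2 * (α - 1) / α with hθdef
  have hθ0 : 0 < θ := by positivity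
  have hθ1 : θ ≤ 1 := by rw [hθdef, div_le_one hα0]; linarith
  set p : ℝ := 2 * (α / (α - 1)) with hp
  set S := ∑ i, s i ^ p with hS
  set T := ∑ j, t j ^ p with hT
  set Q := ∑ k, r k ^ α with hQ
  have hS0 : 0 ≤ S := Finset.sum_nonneg fun i _ => Real.rpow_nonneg (hs i).le _
  have hT0 : 0 ≤ T := Finset.sum_nonneg fun i _ => Real.rpow_nonneg (ht i).le _
  have hQ0 : 0 ≤ Q := Finset.sum_nonneg fun i _ => Real.rpow_nonneg (hr i).le _
  -- the analytic family
  set sz : ℂ → Fin m → ℂ := fun z i => Complex.exp ((Real.log (s i) / θ : ℝ) * z) with hsz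
  set tz : ℂ → Fin m' → ℂ := fun z j => Complex.exp ((Real.log (t j) / θ : ℝ) * z) with htz
  set rz : ℂ → Fin n → ℂ := fun z k =>
    Complex.exp ((α * Real.log (r k) : ℝ) * (1 - z / 2)) with hrz
  set W : ℂ → Matrix.unitaryGroup (Fin d) ℂ → StrongDual ℂ (R →L[ℂ] R) := fun z U =>
    deviationFunctional x y (∑ i, sz z i • InnerProductSpace.rankOne ℂ (e i) (f i))
      (ContinuousLinearMap.adjoint (∑ j, tz z j • InnerProductSpace.rankOne ℂ (g j) (h j)))
      (rz z) U with hW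
  set w : Fin m × Fin m' × Fin n → Matrix.unitaryGroup (Fin d) ℂ → StrongDual ℂ (R →L[ℂ] R) :=
    fun ι U => deviationEntry (x ι.2.2) (y ι.2.2) (f ι.1) (g ι.2.1) U •
      rankOneFunctional (e ι.1) (h ι.2.1) with hw
  have hwc : ∀ ι, Continuous (w ι) := fun ι =>
    (continuous_deviationEntry _ _ _ _).smul continuous_const
  have hWw : ∀ z U, W z U = ∑ ι : Fin m × Fin m' × Fin n,
      Complex.exp ((α * Real.log (r ι.2.2) : ℝ) + (Real.log (s ι.1) / θ + Real.log (t ι.2.1) / θ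
        - α * Real.log (r ι.2.2) / 2 : ℝ) * z) • w ι U := by
    intro z U
    rw [hW]
    simp only [deviationFunctional_eq_sum, Fintype.sum_prod_type, hw]
    refine Finset.sum_congr rfl fun i _ => Finset.sum_congr rfl fun j _ =>
      Finset.sum_congr rfl fun k _ => ?_
    congr 1
    rw [hsz, htz, hrz, ← Complex.exp_add, ← Complex.exp_add]
    congr 1
    push_cast
    ring
  have hsp : ∀ {a : ℝ} (_ : 0 < a) (c : ℝ), Real.exp (Real.log a * c) = a ^ c := fun ha c =>
    (Real.rpow_def_of_pos ha c).symm
  have hrn : ∀ z k, ‖rz z k‖ = r k ^ (α * (1 - z.re / 2)) := fun z k => by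
    rw [hrz, norm_exp_ofReal_mul, ← hsp (hr k)]
    congr 1
    simp
    ring
  have hθp : 1 / θ * 4 = p := by rw [hθdef, hp]; field_simp; norm_num
  have h0 : ∀ z : ℂ, z.re = 0 → ∫ U, ‖W z U‖ ∂haarUnitary d ≤ 2 * Q := by
    intro z hz
    have hA : ‖∑ i, sz z i • InnerProductSpace.rankOne ℂ (e i) (f i)‖ ≤ 1 :=
      norm_sum_rankOne_le_one he hf _ fun i => by rw [hsz, norm_exp_ofReal_mul, hz]; simp
    have hB : ‖ContinuousLinearMap.adjoint
        (∑ j, tz z j • InnerProductSpace.rankOne ℂ (g j) (h j))‖ ≤ 1 := by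
      rw [LinearIsometryEquiv.norm_map]
      exact norm_sum_rankOne_le_one hg hh _ fun i => by rw [htz, norm_exp_ofReal_mul, hz]; simp
    have hR : ∑ k, ‖rz z k‖ = Q := by
      simp only [hrn, hz]; simp [hQ]
    refine (integral_norm_deviationFunctional_le hx.1 hy.1 _ _ _).trans ?_
    rw [hR]
    have := mul_le_one₀ hA (norm_nonneg _) hB
    nlinarith
  have h1 : ∀ z : ℂ, z.re = 1 → ∫ U, ‖W z U‖ ∂haarUnitary d
      ≤ Real.sqrt (Real.sqrt (S * T)) * Real.sqrt (4 / 3 * Q) := by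
    intro z hz
    refine (integral_norm_deviationFunctional_le_schatten_two hx hy.1 he hf hg hh _ _ _).trans
      (le_of_eq ?_)
    have e1 : ∀ {a : ℝ} (_ : 0 < a), Real.exp (Real.log a / θ * z.re) ^ 4 = a ^ p :=
        fun {a} ha => by
      rw [hz, mul_one, div_eq_mul_one_div, hsp ha, ← hθp, Real.rpow_mul ha.le]
      norm_cast
    have e2 : ∀ k, ‖rz z k‖ ^ 2 = r k ^ α := fun k => by
      rw [hrn, hz, ← Real.rpow_natCast, ← Real.rpow_mul (hr k).le]
      congr 1; push_cast; ring
    simp only [e2, hsz, htz, norm_exp_ofReal_mul, e1 (hs _), e1 (ht _)]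
    rfl
  -- at `z = θ` the family passes through the given operators
  have hfin : ∫ U, ‖W θ U‖ ∂haarUnitary d
      ≤ (2 * Q) ^ (1 - θ) * (Real.sqrt (Real.sqrt (S * T)) * Real.sqrt (4 / 3 * Q)) ^ θ := by
    simp only [hWw] at h0 h1 ⊢
    exact integral_norm_expSum_le _ _ hwc ⟨hθ0.le, hθ1⟩ h0 h1
  have hsθ : ∀ i, sz θ i = s i := fun i => by
    simp only [hsz]
    rw [← Complex.ofReal_mul, div_mul_cancel₀ _ hθ0.ne', ← Complex.ofReal_exp, Real.exp_log (hs i)]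
  have htθ : ∀ i, tz θ i = t i := fun i => by
    simp only [htz]
    rw [← Complex.ofReal_mul, div_mul_cancel₀ _ hθ0.ne', ← Complex.ofReal_exp, Real.exp_log (ht i)]
  have hrθ : ∀ i, rz θ i = r i := fun i => by
    simp only [hrz]
    have : (((α * Real.log (r i) : ℝ) : ℂ) * (1 - (θ : ℂ) / 2)) = (Real.log (r i) : ℝ) := by
      have h3 : α * (1 - θ / 2) = 1 := by rw [hθdef]; field_simp; ring
      rw [← Complex.ofReal_one, ← Complex.ofReal_ofNat, ← Complex.ofReal_div, ← Complex.ofReal_sub,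
        ← Complex.ofReal_mul]
      congr 1
      linear_combination Real.log (r i) * h3
    rw [this, ← Complex.ofReal_exp, Real.exp_log (hr i)]
  simp only [hW, hsθ, htθ] at hfin
  rw [funext hrθ] at hfin
  refine decouplingError_le_of_integral_norm_le x y _ _ _ (hfin.trans (le_of_eq ?_))
  -- the constants: `2 ^ (1 - θ) (4 / 3) ^ (θ / 2) = 2 · 3 ^ (-θ / 2)`
  have c1 : θ / 2 = (α - 1) / α := by rw [hθdef]; ring
  have c2 : θ / 4 = 1 / p := by rw [hθdef, hp]; field_simp; norm_num
  have c3 : 1 - θ + θ / 2 = 1 / α := by rw [hθdef]; field_simp; ring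
  have c4 : (1 - α) / α = -(θ / 2) := by rw [c1]; ring
  have hsq : ∀ {a : ℝ}, 0 ≤ a → Real.sqrt a ^ θ = a ^ (θ / 2) := fun {a} ha => by
    rw [Real.sqrt_eq_rpow, ← Real.rpow_mul ha]; congr 1; ring
  have hsq' : ∀ {a : ℝ}, 0 ≤ a → Real.sqrt (Real.sqrt a) ^ θ = a ^ (θ / 4) := fun {a} ha => by
    rw [hsq (Real.sqrt_nonneg _), Real.sqrt_eq_rpow, ← Real.rpow_mul ha]; congr 1; ring
  rw [Real.mul_rpow (by norm_num) hQ0, Real.mul_rpow (Real.sqrt_nonneg _) (Real.sqrt_nonneg _),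
    hsq' (by positivity), hsq (by positivity),
    Real.mul_rpow hS0 hT0, Real.mul_rpow (by norm_num) hQ0, ← c2,
    ← c3, c4, Real.rpow_add_of_nonneg hQ0 (by linarith) (by linarith),
    Real.div_rpow (by norm_num) (by norm_num), Real.rpow_neg (by norm_num)]
  have h4 : (4 : ℝ) ^ (θ / 2) = 2 ^ θ := by
    rw [show (4 : ℝ) = 2 ^ (2 : ℝ) by norm_num, ← Real.rpow_mul (by norm_num)]
    congr 1; ring
  have h2 : (2 : ℝ) ^ (1 - θ) * 2 ^ θ = 2 := by
    rw [← Real.rpow_add (by norm_num)]; simp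
  rw [h4]
  linear_combination (Q ^ (1 - θ) * (S ^ (θ / 4) * T ^ (θ / 4)) * ((3 : ℝ) ^ (θ / 2))⁻¹ *
    Q ^ (θ / 2)) * h2

/-- The endpoint `α = 1` for operators of finite rank. -/
theorem decouplingError_finiteRank_le_one {n : ℕ} {x y : Fin n → AATensor d R}
    (hx : ∀ k, ‖x k‖ = 1) (hy : ∀ k, ‖y k‖ = 1) (a b : R →L[ℂ] R) {r : Fin n → ℝ}
    (hr : ∀ k, 0 < r k) :
    decouplingError (onR d a ∘L (∑ k, (r k : ℂ) • InnerProductSpace.rankOne ℂ (x k) (y k)) ∘L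
      onR d b) ≤ ENNReal.ofReal (2 * ‖a‖ * ‖b‖ * ∑ k, r k) := by
  refine decouplingError_le_of_integral_norm_le x y a b _
    ((integral_norm_deviationFunctional_le hx hy _ _ _).trans (le_of_eq ?_))
  rw [LinearIsometryEquiv.norm_map]
  simp [abs_of_pos (hr _)]

end FiniteRank

/-! ### General operators and the conditional entropy -/

section Main

variable {d : ℕ} {R : Type*} [NormedAddCommGroup R] [InnerProductSpace ℂ R]

theorem onR_zero : onR d (0 : R →L[ℂ] R) = 0 := by
  ext x q; simp [onR]

theorem continuous_onR :
    Continuous (onR d : (R →L[ℂ] R) → AATensor d R →L[ℂ] AATensor d R) := by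
  have h : LipschitzWith 1 (onR d : (R →L[ℂ] R) → AATensor d R →L[ℂ] AATensor d R) := by
    refine LipschitzWith.of_dist_le_mul fun a b => ?_
    rw [dist_eq_norm, dist_eq_norm, NNReal.coe_one, one_mul]
    refine ContinuousLinearMap.opNorm_le_bound _ (norm_nonneg _) fun x => ?_
    refine le_of_sq_le_sq ?_ (by positivity)
    rw [AATensor.norm_sq_eq, mul_pow, AATensor.norm_sq_eq, Finset.mul_sum]
    refine Finset.sum_le_sum fun q _ => ?_
    rw [← mul_pow]
    gcongr
    exact (a - b).le_opNorm (x q)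
  exact h.continuous

variable [CompleteSpace R]

theorem exists_finiteRank_approx_schattenNorm {H : Type*} [NormedAddCommGroup H]
    [InnerProductSpace ℂ H] [CompleteSpace H] {T : H →L[ℂ] H} {p ε : ℝ} (hp : 1 ≤ p) (hε : 0 < ε)
    (hT : schattenNorm (ENNReal.ofReal p) T ≠ ∞) :
    ∃ (n : ℕ) (s : Fin n → ℝ) (e f : Fin n → H), (∀ i, 0 < s i) ∧ Orthonormal ℂ e ∧
      Orthonormal ℂ f ∧
      ‖T - ∑ i, (s i : ℂ) • InnerProductSpace.rankOne ℂ (e i) (f i)‖ ≤ ε ∧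
      ENNReal.ofReal ((∑ i, s i ^ p) ^ (1 / p)) ≤ schattenNorm (ENNReal.ofReal p) T := by
  have hp0 : 0 < p := by linarith
  rw [schattenNorm_ofReal hp0.le] at hT ⊢
  have htr : posTrace (CFC.abs T ^ p) ≠ ∞ := fun h => hT (by
    rw [h, ENNReal.top_rpow_of_pos (by positivity)])
  obtain ⟨n, s, e, f, hs, he, hf, h1, h2⟩ := exists_finiteRank_approx T hp hε htr
  refine ⟨n, s, e, f, hs, he, hf, h1, ?_⟩
  rw [← ENNReal.ofReal_rpow_of_nonneg (Finset.sum_nonneg fun i _ => Real.rpow_nonneg (hs i).le _)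
    (by positivity)]
  gcongr

theorem eq_zero_of_schattenNorm_eq_zero {H : Type*} [NormedAddCommGroup H]
    [InnerProductSpace ℂ H] [CompleteSpace H] {T : H →L[ℂ] H} {p : ℝ} (hp : 1 ≤ p)
    (hT : schattenNorm (ENNReal.ofReal p) T = 0) : T = 0 := by
  have h : ∀ ε > 0, ‖T‖ ≤ ε := by
    intro ε hε
    obtain ⟨n, s, e, f, hs, he, hf, h1, h2⟩ :=
      exists_finiteRank_approx_schattenNorm hp hε (by rw [hT]; exact ENNReal.zero_ne_top)
    rw [hT, nonpos_iff_eq_zero, ENNReal.ofReal_eq_zero] at h2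
    cases n with
    | zero => simpa using h1
    | succ n =>
      have : 0 < (∑ i, s i ^ p) ^ (1 / p) :=
        Real.rpow_pos_of_pos (Finset.sum_pos (fun i _ => Real.rpow_pos_of_pos (hs i) p)
          Finset.univ_nonempty) _
      linarith
  exact norm_le_zero_iff.1 (le_of_forall_pos_le_add fun ε hε => by simpa using h ε hε)

theorem exists_seq_finiteRank_approx {H : Type*} [NormedAddCommGroup H]
    [InnerProductSpace ℂ H] [CompleteSpace H] {T : H →L[ℂ] H} {p : ℝ} (hp : 1 ≤ p)
    (hT : schattenNorm (ENNReal.ofReal p) T ≠ ∞) :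
    ∃ (n : ℕ → ℕ) (s : ∀ N, Fin (n N) → ℝ) (e f : ∀ N, Fin (n N) → H), (∀ N i, 0 < s N i) ∧
      (∀ N, Orthonormal ℂ (e N)) ∧ (∀ N, Orthonormal ℂ (f N)) ∧
      Filter.Tendsto (fun N => ∑ i, (s N i : ℂ) • InnerProductSpace.rankOne ℂ (e N i) (f N i))
        Filter.atTop (nhds T) ∧
      ∀ N, ENNReal.ofReal ((∑ i, s N i ^ p) ^ (1 / p)) ≤ schattenNorm (ENNReal.ofReal p) T := by
  have h := fun N : ℕ => exists_finiteRank_approx_schattenNorm hp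
    (Nat.one_div_pos_of_nat (n := N) : (0 : ℝ) < _) hT
  choose n s e f hs he hf h1 h2 using h
  refine ⟨n, s, e, f, hs, he, hf, ?_, h2⟩
  rw [tendsto_iff_norm_sub_tendsto_zero]
  refine squeeze_zero (fun _ => norm_nonneg _) (fun N => ?_)
    tendsto_one_div_add_atTop_nhds_zero_nat
  rw [norm_sub_rev]
  exact h1 N

theorem decouplingError_zero : decouplingError (0 : AATensor d R →L[ℂ] AATensor d R) = 0 := by
  have h := decouplingError_finiteRank_le_one (n := 0) (d := d) (R := R) (x := fun _ => 0)
    (y := fun _ => 0) (fun k => k.elim0) (fun k => k.elim0) 0 0 (r := fun _ => 0)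
    (fun k => k.elim0)
  simpa using h

/-- The interpolated bound for one factorization `(1 ⊗ a) Z (1 ⊗ b)`, `1 < α ≤ 2`. -/
theorem decouplingError_factorization_le {α : ℝ} (hα : 1 < α) (hα2 : α ≤ 2) (a b : R →L[ℂ] R)
    (Z : AATensor d R →L[ℂ] AATensor d R) :
    decouplingError (onR d a ∘L Z ∘L onR d b) ≤ 2 * (3 : ℝ≥0∞) ^ ((1 - α) / α) *
      (schattenNorm (ENNReal.ofReal (2 * (α / (α - 1)))) a * schattenNorm (ENNReal.ofReal α) Z *
        schattenNorm (ENNReal.ofReal (2 * (α / (α - 1)))) b) := by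
  have hα1 : 0 < α - 1 := by linarith
  have hp1 : 1 ≤ 2 * (α / (α - 1)) := by
    rw [mul_div_assoc', le_div_iff₀ hα1]; linarith
  have hc0 : 2 * (3 : ℝ≥0∞) ^ ((1 - α) / α) ≠ 0 := by
    have : (3 : ℝ≥0∞) ^ ((1 - α) / α) ≠ 0 := by simp [ENNReal.rpow_eq_zero_iff]
    exact mul_ne_zero two_ne_zero this
  -- a vanishing factor makes the operator zero, so that `0 * ∞ = 0` on the right does no harm
  by_cases ha : schattenNorm (ENNReal.ofReal (2 * (α / (α - 1)))) a = 0
  · rw [eq_zero_of_schattenNorm_eq_zero hp1 ha, onR_zero, ContinuousLinearMap.zero_comp,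
      decouplingError_zero]
    exact zero_le
  by_cases hb : schattenNorm (ENNReal.ofReal (2 * (α / (α - 1)))) b = 0
  · rw [eq_zero_of_schattenNorm_eq_zero hp1 hb, onR_zero, ContinuousLinearMap.comp_zero,
      ContinuousLinearMap.comp_zero, decouplingError_zero]
    exact zero_le
  by_cases hZ : schattenNorm (ENNReal.ofReal α) Z = 0
  · rw [eq_zero_of_schattenNorm_eq_zero hα.le hZ, ContinuousLinearMap.zero_comp,
      ContinuousLinearMap.comp_zero, decouplingError_zero]
    exact zero_le
  by_cases ha' : schattenNorm (ENNReal.ofReal (2 * (α / (α - 1)))) a = ∞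
  · rw [ha', ENNReal.top_mul hZ, ENNReal.top_mul hb, ENNReal.mul_top hc0]; exact le_top
  by_cases hb' : schattenNorm (ENNReal.ofReal (2 * (α / (α - 1)))) b = ∞
  · rw [hb', ENNReal.mul_top (mul_ne_zero ha hZ), ENNReal.mul_top hc0]; exact le_top
  by_cases hZ' : schattenNorm (ENNReal.ofReal α) Z = ∞
  · rw [hZ', ENNReal.mul_top ha, ENNReal.top_mul hb, ENNReal.mul_top hc0]; exact le_top
  -- the norms are now positive and finite, and all three factors have finite-rank approximations
  obtain ⟨m, s, e, f, hs, he, hf, hsa, hsn⟩ := exists_seq_finiteRank_approx hp1 ha'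
  obtain ⟨m', t, g, h, ht, hg, hh, htb, htn⟩ := exists_seq_finiteRank_approx hp1 hb'
  obtain ⟨n, r, x, y, hr, hx, hy, hrZ, hrn⟩ := exists_seq_finiteRank_approx hα.le hZ'
  have hcont : Continuous fun w : (R →L[ℂ] R) × (AATensor d R →L[ℂ] AATensor d R) × (R →L[ℂ] R) =>
      onR d w.1 ∘L w.2.1 ∘L onR d w.2.2 := by
    have := continuous_onR (d := d) (R := R)
    fun_prop
  refine decouplingError_le_of_tendsto
    ((hcont.tendsto (a, Z, b)).comp (hsa.prodMk_nhds (hrZ.prodMk_nhds htb))) fun N => ?_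
  refine (decouplingError_finiteRank_le hα hα2 (hx N) (hy N) (he N) (hf N) (hg N) (hh N) (hs N)
    (ht N) (hr N)).trans ?_
  have hS := Real.rpow_nonneg (Finset.sum_nonneg fun i _ =>
    Real.rpow_nonneg (hs N i).le (2 * (α / (α - 1))) :
    0 ≤ ∑ i, s N i ^ (2 * (α / (α - 1)))) (1 / (2 * (α / (α - 1))))
  have hQ := Real.rpow_nonneg (Finset.sum_nonneg fun i _ =>
    Real.rpow_nonneg (hr N i).le α : 0 ≤ ∑ i, r N i ^ α) (1 / α)
  rw [ENNReal.ofReal_mul (by positivity), ENNReal.ofReal_mul (by positivity),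
    ENNReal.ofReal_mul (by positivity), ENNReal.ofReal_mul hS,
    ← ENNReal.ofReal_rpow_of_pos (by norm_num), ENNReal.ofReal_ofNat, ENNReal.ofReal_ofNat]
  gcongr
  · exact hsn N
  · exact hrn N
  · exact htn N

/-- The endpoint `α = 1` for one factorization `(1 ⊗ a) Z (1 ⊗ b)`. -/
theorem decouplingError_factorization_le_one (a b : R →L[ℂ] R)
    (Z : AATensor d R →L[ℂ] AATensor d R) :
    decouplingError (onR d a ∘L Z ∘L onR d b) ≤ 2 * (‖a‖ₑ * schattenNorm 1 Z * ‖b‖ₑ) := by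
  by_cases ha : a = 0
  · rw [ha, onR_zero, ContinuousLinearMap.zero_comp, decouplingError_zero]
    exact zero_le
  by_cases hb : b = 0
  · rw [hb, onR_zero, ContinuousLinearMap.comp_zero, ContinuousLinearMap.comp_zero,
      decouplingError_zero]
    exact zero_le
  by_cases hZ : schattenNorm 1 Z = ∞
  · rw [hZ, ENNReal.mul_top (by simpa using ha), ENNReal.top_mul (by simpa using hb),
      ENNReal.mul_top two_ne_zero]
    exact le_top
  rw [← ENNReal.ofReal_one] at hZ ⊢
  obtain ⟨n, r, x, y, hr, hx, hy, hrZ, hrn⟩ := exists_seq_finiteRank_approx le_rfl hZ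
  have hcont : Continuous fun w : AATensor d R →L[ℂ] AATensor d R =>
      onR d a ∘L w ∘L onR d b := by fun_prop
  refine decouplingError_le_of_tendsto ((hcont.tendsto Z).comp hrZ) fun N => ?_
  refine (decouplingError_finiteRank_le_one (hx N).1 (hy N).1 a b (hr N)).trans ?_
  have h1 := hrn N
  simp only [Real.rpow_one, div_one] at h1
  rw [ENNReal.ofReal_mul (by positivity), ENNReal.ofReal_mul (by positivity),
    ENNReal.ofReal_mul (by positivity), ofReal_norm, ofReal_norm, ENNReal.ofReal_ofNat]
  calc 2 * ‖a‖ₑ * ‖b‖ₑ * ENNReal.ofReal (∑ k, r N k)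
      ≤ 2 * ‖a‖ₑ * ‖b‖ₑ * schattenNorm (ENNReal.ofReal 1) Z := by gcongr
    _ = _ := by ring

theorem two_mul_conjExponent {α : ℝ} (hα : 1 < α) :
    2 * ENNReal.conjExponent (ENNReal.ofReal α) = ENNReal.ofReal (2 * (α / (α - 1))) := by
  have hα1 : 0 < α - 1 := by linarith
  rw [ENNReal.conjExponent, ← ENNReal.ofReal_one, ← ENNReal.ofReal_sub _ zero_le_one,
    ← ENNReal.ofReal_inv_of_pos hα1, ← ENNReal.ofReal_add zero_le_one (by positivity),
    ← ENNReal.ofReal_ofNat, ← ENNReal.ofReal_mul (by norm_num)]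
  congr 2
  field_simp
  ring

theorem ENNReal.le_const_mul_of_div_le {x c N : ℝ≥0∞} (hc : c ≠ 0) (hc' : c ≠ ∞) (h : x / c ≤ N) :
    x ≤ c * N := by
  rw [ENNReal.div_le_iff hc hc'] at h
  rwa [mul_comm]

theorem decouplingError_le_normS1 {α : ℝ} (hα : 1 ≤ α) (hα2 : α ≤ 2)
    (Y : AATensor d R →L[ℂ] AATensor d R) :
    decouplingError Y ≤ 2 * (3 : ℝ≥0∞) ^ ((1 - α) / α) * normS1 α Y := by
  have hc0 : 2 * (3 : ℝ≥0∞) ^ ((1 - α) / α) ≠ 0 := by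
    have : (3 : ℝ≥0∞) ^ ((1 - α) / α) ≠ 0 := by simp [ENNReal.rpow_eq_zero_iff]
    exact mul_ne_zero two_ne_zero this
  have hc1 : 2 * (3 : ℝ≥0∞) ^ ((1 - α) / α) ≠ ∞ :=
    ENNReal.mul_ne_top ENNReal.ofNat_ne_top
      (ENNReal.rpow_ne_top_of_ne_zero (by norm_num) ENNReal.ofNat_ne_top)
  refine ENNReal.le_const_mul_of_div_le hc0 hc1 ?_
  refine le_iInf fun a => le_iInf fun b => le_iInf fun Z => le_iInf fun hY => ?_
  refine ENNReal.div_le_of_le_mul' ?_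
  rw [hY]
  rcases hα.eq_or_lt with rfl | hα1
  · have h1 : 2 * ENNReal.conjExponent (ENNReal.ofReal 1) = ∞ := by
      simp [ENNReal.conjExponent, ENNReal.mul_top]
    rw [h1]
    simpa [schattenNorm] using decouplingError_factorization_le_one a b Z
  · rw [two_mul_conjExponent hα1]
    exact decouplingError_factorization_le hα1 hα2 a b Z

/-- `‖σ^{1/p}‖_p = (Tr σ)^{1/p} = 1` for a density operator `σ`. -/
theorem schattenNorm_rpow_of_isDensityOperator {σ : R →L[ℂ] R} (hσ : IsDensityOperator σ) {p : ℝ}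
    (hp : 0 < p) : schattenNorm (ENNReal.ofReal p) (σ ^ (1 / p)) = 1 := by
  have hσ0 : 0 ≤ σ := (ContinuousLinearMap.nonneg_iff_isPositive σ).2 hσ.1
  rw [schattenNorm_ofReal hp.le, CFC.abs_of_nonneg _ CFC.rpow_nonneg,
    CFC.rpow_rpow_of_exponent_nonneg _ _ _ (by positivity) hp.le, one_div_mul_cancel hp.ne',
    CFC.rpow_one σ hσ0, hσ.2, ENNReal.one_rpow]

theorem decouplingError_le_iInf_sandwichedNorm {α : ℝ} (hα : 1 < α) (hα2 : α ≤ 2)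
    (τ : AATensor d R →L[ℂ] AATensor d R) :
    decouplingError τ ≤ 2 * (3 : ℝ≥0∞) ^ ((1 - α) / α) *
      ⨅ (σ : R →L[ℂ] R) (_ : IsDensityOperator σ),
        sandwichedNorm α (1 / (2 * (α / (α - 1)))) σ τ := by
  refine (decouplingError_le_normS1 hα.le hα2 τ).trans ?_
  gcongr
  refine le_iInf fun σ => le_iInf fun hσ => le_iInf fun Z => le_iInf fun hτ => ?_
  have hα1 : 0 < α - 1 := by linarith
  refine (iInf_le_of_le (σ ^ (1 / (2 * (α / (α - 1))))) (iInf_le_of_le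
    (σ ^ (1 / (2 * (α / (α - 1))))) (iInf_le_of_le Z (iInf_le _ hτ)))).trans (le_of_eq ?_)
  rw [two_mul_conjExponent hα, schattenNorm_rpow_of_isDensityOperator hσ (by positivity), one_mul,
    mul_one]

/-- The bound in terms of `N = inf_σ ‖·‖_α`, rewritten with `H = -α' log N`. At the extreme values,
`N = 0` gives `0` on the left and `N = ∞` gives `H = -∞` and `∞` on the right. -/
theorem const_mul_le_exp_entropy {α : ℝ} (hα : 1 < α) (N : ℝ≥0∞) :
    2 * (3 : ℝ≥0∞) ^ ((1 - α) / α) * N ≤ 2 * EReal.exp ((((1 - α) / α : ℝ) : EReal) *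
      (-((α / (α - 1) : ℝ) : EReal) * ENNReal.log N + ((Real.log 3 : ℝ) : EReal))) := by
  have hα1 : 0 < α - 1 := by linarith
  have hα0 : 0 < α := by linarith
  have hneg : (1 - α) / α < 0 := div_neg_of_neg_of_pos (by linarith) hα0
  have hneg' : -(α / (α - 1)) < 0 := neg_lt_zero.2 (by positivity)
  rw [← EReal.coe_neg]
  rcases eq_or_ne N 0 with rfl | hN0
  · simp
  rcases eq_or_ne N ∞ with rfl | hN1
  · rw [ENNReal.log_top, EReal.coe_mul_top_of_neg hneg', EReal.bot_add,
      EReal.coe_mul_bot_of_neg hneg, EReal.exp_top, ENNReal.mul_top two_ne_zero]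
    exact le_top
  · obtain ⟨x, hx, rfl⟩ : ∃ x : ℝ, 0 < x ∧ N = ENNReal.ofReal x :=
      ⟨N.toReal, ENNReal.toReal_pos hN0 hN1, (ENNReal.ofReal_toReal hN1).symm⟩
    rw [ENNReal.log_ofReal_of_pos hx, ← EReal.coe_mul, ← EReal.coe_add, ← EReal.coe_mul,
      EReal.exp_coe, mul_assoc]
    have h1 : (1 - α) / α * (-(α / (α - 1)) * Real.log x + Real.log 3)
        = Real.log 3 * ((1 - α) / α) + Real.log x := by
      field_simp; ring
    rw [h1, Real.exp_add, Real.exp_log hx, ← Real.rpow_def_of_pos (by norm_num),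
      ENNReal.ofReal_mul (by positivity), ← ENNReal.ofReal_rpow_of_pos (by norm_num),
      ENNReal.ofReal_ofNat]

theorem schattenNorm_one_of_isPositive {H : Type*} [NormedAddCommGroup H]
    [InnerProductSpace ℂ H] [CompleteSpace H] {T : H →L[ℂ] H} (hT : T.IsPositive) :
    schattenNorm 1 T = posTrace T := by
  rw [schattenNorm_one_eq,
    CFC.abs_of_nonneg T ((ContinuousLinearMap.nonneg_iff_isPositive T).2 hT)]

theorem decouplingError_le_two_mul_posTrace {τ : AATensor d R →L[ℂ] AATensor d R}
    (hτ : τ.IsPositive) : decouplingError τ ≤ 2 * posTrace τ := by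
  have h := decouplingError_factorization_le_one (1 : R →L[ℂ] R) 1 τ
  have h1 : onR d (1 : R →L[ℂ] R) ∘L τ ∘L onR d 1 = τ := by
    have : onR d (1 : R →L[ℂ] R) = ContinuousLinearMap.id ℂ _ := by ext x q; rfl
    rw [this, ContinuousLinearMap.comp_id, ContinuousLinearMap.id_comp]
  have h2 : ‖(1 : R →L[ℂ] R)‖ₑ ≤ 1 := by
    rw [← ofReal_norm, ENNReal.ofReal_le_one]
    exact ContinuousLinearMap.norm_id_le
  rw [h1, schattenNorm_one_of_isPositive hτ] at h
  refine h.trans ?_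
  gcongr
  calc _ ≤ 1 * posTrace τ * 1 := by gcongr
    _ = _ := by simp

end Main

theorem theorem3p3 {C E : Type*}
    [NormedAddCommGroup C] [InnerProductSpace ℂ C] [CompleteSpace C]
    [NormedAddCommGroup E] [InnerProductSpace ℂ E] [CompleteSpace E] (d : ℕ) :
    (∀ Y : AATensor d (HilbertTensor C E) →L[ℂ] AATensor d (HilbertTensor C E),
      schattenNorm 1 Y < ∞ →
        Measurable (decouplingDeviation Y) ∧
        ∀ α : ℝ, 1 ≤ α → α ≤ 2 →
          decouplingError Y ≤ 2 * (3 : ℝ≥0∞) ^ ((1 - α) / α) * normS1 α Y) ∧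
    (∀ τ : AATensor d (HilbertTensor C E) →L[ℂ] AATensor d (HilbertTensor C E),
      τ.IsPositive →
        (∀ α : ℝ, 1 < α → α ≤ 2 →
          decouplingError τ ≤ 2 * EReal.exp ((((1 - α) / α : ℝ) : EReal) *
            (sandwichedEntropy α τ + ((Real.log 3 : ℝ) : EReal)))) ∧
        decouplingError τ ≤ 2 * posTrace τ) := by
  refine ⟨fun Y _ => ⟨measurable_decouplingDeviation Y, fun α hα hα2 =>
    decouplingError_le_normS1 hα hα2 Y⟩, fun τ hτ => ⟨fun α hα hα2 => ?_,
    decouplingError_le_two_mul_posTrace hτ⟩⟩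
  exact (decouplingError_le_iInf_sandwichedNorm hα hα2 τ).trans (const_mul_le_exp_entropy hα _)
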